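/- Let $d\ge 1$, let $\Omega\subset\mathbb R^d$ be a bounded Lipschitz domain, $T>0$, $I=(0,T)$, $U:=L^2(I\times\Omega)$, and let $s\in(0,1)$. Let $W$ be one of the four fractional Sobolev spaces $H^s(\Omega)$, $H^s_0(\Omega)$, $\tilde H^s(\Omega)$, $\mathbb H^s(\Omega)$, where: * $H^s(\Omega)$ is the space of all $w\in L^2(\Omega)$ for which $$\|w\|_{H^s(\Omega)}^2=\int_\Omega |w|^2\,dx+\frac{c_{d,s}}2\int_\Omega\int_\Omega\frac{|w(x)-w(y)|^2}{|x-y|^{d+2s}}\,dy\,dx<\infty,\qquad c_{d,s}=\frac{s2^{2s}\Gamma(s+\frac d2)}{\pi^{d/2}\Gamma(1-s)};$$ * $H^s_0(\Omega)$ is the closure of $C_c^\infty(\Omega)$ in $H^s(\Omega)$, with the norm of $H^s(\Omega)$; * $\tilde H^s(\Omega)$ is the space of all $w\in L^2(\Omega)$ whose extension by zero belongs to $H^s(\mathbb R^d)$, with the $H^s(\mathbb R^d)$-norm of this extension; * $\mathbb H^s(\Omega)$ is the space of all $w\in L^2(\Omega)$ with $\|w\|_{\mathbb H^s(\Omega)}^2=\sum_n\lambda_n^s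 w_n^2<\infty$, where $w_n=\int_\Omega w\phi_n\,dx$ and $(\phi_n)$ is an orthonormal basis of $L^2(\Omega)$ of eigenfunctions of $-\Delta$ with zero Dirichlet boundary conditions, with eigenvalues $\lambda_n$. Let $f:U\to\mathbb R$ be weakly lower semicontinuous, continuously Fréchet differentiable and bounded from below by a continuous affine function, let $\alpha,\beta,\gamma>0$ and $p\in(0,1)$. For $\epsilon\ge0$ put $$\psi_\epsilon(t)=\begin{cases}\frac p2\frac{t}{\epsilon^{2-p}}+(1-\frac p2)\epsilon^p,& 0\le t<\epsilon^2,\\ t^{p/2},& t\ge\epsilon^2,\end{cases}\qquad G_\epsilon(w)=\int_\Omega\psi_\epsilon(|w|^2)\,dx,$$ $$\Phi_\epsilon(u,w)=f(u)+\frac\alpha2\|u\|_U^2+\frac\beta2\|w\|_W^2+\gamma G_\epsilon(w),$$ so that $G_0(w)=\int_\Omega|w|^p\,dx$. Let $K$ be the set of all $(u,w)\in U\times W$ with $|u(t,x)|\le w(x)$ for almost all $(t,x)\in I\times\Omega$. Let $(\bar u,\bar w)\in K$ be a local minimizer of $\Phi_0$ on $K$, and let $\rho>0$ be such that $\Phi_0(\bar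 u,\bar w)\le\Phi_0(u,w)$ for all $(u,w)\in K$ with $\|u-\bar u\|_U\le\rho$ and $\|w-\bar w\|_W\le\rho$. For $\epsilon>0$ consider the auxiliary problem of minimizing $$\Phi_\epsilon(u,w)+\frac12\|u-\bar u\|_U^2+\frac12\|w-\bar w\|_{L^2(\Omega)}^2+\frac1{2\epsilon}\|(w-u)_-\|_U^2+\frac1{2\epsilon}\|(w+u)_-\|_U^2$$ over all $(u,w)\in U\times W$ with $\|u-\bar u\|_U\le\rho$ and $\|w-\bar w\|_W\le\rho$, where $v_-=\min(v,0)$ and $w$ is extended to $I\times\Omega$ by $w(t,x)=w(x)$. Let $\epsilon_k>0$ with $\epsilon_k\to0$, and for each $k$ let $(u_k,w_k)$ be a (global) solution of the auxiliary problem with $\epsilon=\epsilon_k$. Then $u_k\to\bar u$ strongly in $U=L^2(I\times\Omega)$ and $w_k\to\bar w$ strongly in $W$. -/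

import Mathlib

open MeasureTheory Set Filter Topology
open scoped ENNReal NNReal ContDiff InnerProductSpace

noncomputable section

namespace SparseFrac

/-- The space `ℝ^d` with its Euclidean norm. -/
abbrev E (d : ℕ) : Type := EuclideanSpace ℝ (Fin d)

/-- `Ω` is a bounded Lipschitz domain in `ℝ^d`: nonempty, open, connected, bounded, and near every
boundary point it is the strict epigraph, in the direction of some unit vector `ν`, of a Lipschitz
function `g` on the hyperplane orthogonal to `ν`. -/
structure IsBoundedLipschitzDomain {d : ℕ} (Ω : Set (E d)) : Prop where
  isOpen : IsOpen Ω
  isConnected : IsConnected Ω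
  isBounded : Bornology.IsBounded Ω
  lipschitz_boundary : ∀ x₀ ∈ frontier Ω, ∃ r : ℝ, 0 < r ∧ ∃ ν : E d, ‖ν‖ = 1 ∧
    ∃ (L : ℝ≥0) (g : (ℝ ∙ ν)ᗮ → ℝ), LipschitzWith L g ∧
      ∀ x ∈ Metric.ball x₀ r,
        (x ∈ Ω ↔ g ((ℝ ∙ ν)ᗮ.orthogonalProjectionOnto x) < ⟪ν, x⟫_ℝ)

/-- `L²(Ω)`. -/
abbrev L2 {d : ℕ} (Ω : Set (E d)) : Type := Lp ℝ 2 (volume.restrict Ω : Measure (E d))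

/-- `L²(Ω; ℝ^d)`. -/
abbrev L2Vec {d : ℕ} (Ω : Set (E d)) : Type := Lp (E d) 2 (volume.restrict Ω : Measure (E d))

/-- Lebesgue measure on the time-space cylinder `I × Ω`, with `I = (0, T)`. -/
def cylMeasure {d : ℕ} (T : ℝ) (Ω : Set (E d)) : Measure (ℝ × E d) :=
  (volume.restrict (Ioo (0 : ℝ) T)).prod (volume.restrict Ω)

/-- `U = L²(I × Ω)`. -/
abbrev U {d : ℕ} (T : ℝ) (Ω : Set (E d)) : Type := Lp ℝ 2 (cylMeasure T Ω)

/-- `φ ∈ C_c^∞(Ω)`. -/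
def IsTestFunction {d : ℕ} (Ω : Set (E d)) (φ : E d → ℝ) : Prop :=
  ContDiff ℝ ∞ φ ∧ HasCompactSupport φ ∧ tsupport φ ⊆ Ω

/-! ### Fractional Sobolev spaces -/

/-- The constant `c_{d,s} = s 2^{2s} Γ(s + d/2) / (π^{d/2} Γ(1 - s))`. -/
def fracConst (d : ℕ) (s : ℝ) : ℝ :=
  s * (2 : ℝ) ^ (2 * s) * Real.Gamma (s + (d : ℝ) / 2) /
    (Real.pi ^ ((d : ℝ) / 2) * Real.Gamma (1 - s))

/-- The squared `H^s(D)`-norm, with values in `[0, ∞]`, of a function `v`. -/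
def hsNormSq {d : ℕ} (s : ℝ) (D : Set (E d)) (v : E d → ℝ) : ℝ≥0∞ :=
  (∫⁻ x in D, ENNReal.ofReal (v x ^ 2)) +
    ENNReal.ofReal (fracConst d s / 2) *
      ∫⁻ x in D, ∫⁻ y in D,
        ENNReal.ofReal ((v x - v y) ^ 2 / ‖x - y‖ ^ ((d : ℝ) + 2 * s))

/-- The pairs `(w, ∇w)` with `w ∈ H¹₀(Ω)`: the closure in `L²(Ω) × L²(Ω; ℝ^d)` of the pairs
`(φ, ∇φ)` with `φ ∈ C_c^∞(Ω)`. -/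
def h10Graph {d : ℕ} (Ω : Set (E d)) : Set (L2 Ω × L2Vec Ω) :=
  closure {q | ∃ φ : E d → ℝ, IsTestFunction Ω φ ∧
    q.1 =ᵐ[volume.restrict Ω] φ ∧ q.2 =ᵐ[volume.restrict Ω] fun x => gradient φ x}

/-- `w ∈ H¹₀(Ω)` is a weak solution of `-Δw = μ w` in `Ω`, `w = 0` on `∂Ω`. -/
def IsDirichletEigenfunction {d : ℕ} (Ω : Set (E d)) (μ : ℝ) (w : L2 Ω) : Prop :=
  ∃ G : L2Vec Ω, (w, G) ∈ h10Graph Ω ∧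
    ∀ φ : E d → ℝ, IsTestFunction Ω φ →
      ∫ x in Ω, ⟪G x, gradient φ x⟫_ℝ = μ * ∫ x in Ω, w x * φ x

/-- The eigenspace in `L²(Ω)` of the Dirichlet Laplacian `-Δ` for the number `μ`; it is trivial
if `μ` is not an eigenvalue. (The weak solutions already form a closed subspace; `span` and closure
only make this part of the type.) -/
def dirichletEigenspace {d : ℕ} (Ω : Set (E d)) (μ : ℝ) : Submodule ℝ (L2 Ω) :=
  (Submodule.span ℝ {w | IsDirichletEigenfunction Ω μ w}).topologicalClosure

instance {d : ℕ} (Ω : Set (E d)) (μ : ℝ) : CompleteSpace (dirichletEigenspace Ω μ) :=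
  (Submodule.isClosed_topologicalClosure _).completeSpace_coe

/-- The squared spectral norm `∑ₙ λₙ^s wₙ²`, where `wₙ` are the coefficients of `w` in an
orthonormal basis of Dirichlet eigenfunctions of `-Δ`, with eigenvalues `λₙ`. The terms with the
same eigenvalue `μ` add up to `μ^s` times the squared norm of the orthogonal projection of `w` to
the eigenspace of `μ`, so no basis has to be chosen. -/
def spectralNormSq {d : ℕ} (s : ℝ) (Ω : Set (E d)) (w : L2 Ω) : ℝ≥0∞ :=
  ∑' μ : ℝ, ENNReal.ofReal (μ ^ s) *
    ENNReal.ofReal (‖(dirichletEigenspace Ω μ).orthogonalProjectionOnto w‖ ^ 2)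

/-- The four kinds of fractional Sobolev spaces on `Ω`: `H^s(Ω)`, `H₀^s(Ω)`, `H̃^s(Ω)` and the
spectral space `ℍ^s(Ω)`. -/
inductive SpaceKind : Type
  | full
  | zero
  | tilde
  | spectral

/-- The squared norm `‖w‖_W²`, with values in `[0, ∞]`; for `H̃^s(Ω)` it is the squared
`H^s(ℝ^d)`-norm of the extension by zero. -/
def wNormSq {d : ℕ} (κ : SpaceKind) (s : ℝ) (Ω : Set (E d)) (w : L2 Ω) : ℝ≥0∞ :=
  match κ with
  | .full => hsNormSq s Ω w
  | .zero => hsNormSq s Ω w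
  | .tilde => hsNormSq s univ (Ω.indicator w)
  | .spectral => spectralNormSq s Ω w

/-- The space `W`, as a set of elements of `L²(Ω)`: the functions of finite `W`-norm and, in the
case of `H₀^s(Ω)`, only those in the closure of `C_c^∞(Ω)` with respect to the `H^s(Ω)`-norm. -/
def W {d : ℕ} (κ : SpaceKind) (s : ℝ) (Ω : Set (E d)) : Set (L2 Ω) :=
  match κ with
  | .full => {w | wNormSq .full s Ω w < ⊤}
  | .zero => {w | wNormSq .zero s Ω w < ⊤ ∧
      ∀ δ : ℝ≥0∞, 0 < δ → ∃ φ : E d → ℝ, IsTestFunction Ω φ ∧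
        hsNormSq s Ω (fun x => w x - φ x) < δ}
  | .tilde => {w | wNormSq .tilde s Ω w < ⊤}
  | .spectral => {w | wNormSq .spectral s Ω w < ⊤}

/-- The norm `‖w‖_W`; it is finite for `w ∈ W`. -/
def wNorm {d : ℕ} (κ : SpaceKind) (s : ℝ) (Ω : Set (E d)) (w : L2 Ω) : ℝ≥0∞ :=
  wNormSq κ s Ω w ^ (1 / 2 : ℝ)

/-! ### The optimization problems -/

/-- Weak (sequential) lower semicontinuity of a function on a Hilbert space. -/
def WeaklyLSC {H : Type*} [NormedAddCommGroup H] [InnerProductSpace ℝ H] (f : H → ℝ) : Prop :=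
  ∀ (u : ℕ → H) (u₀ : H), (∀ v : H, Tendsto (fun n => ⟪u n, v⟫_ℝ) atTop (𝓝 ⟪u₀, v⟫_ℝ)) →
    (f u₀ : EReal) ≤ liminf (fun n => (f (u n) : EReal)) atTop

/-- The smooth approximation `ψ_ε` of `t ↦ t^{p/2}` on `[0, ∞)`. -/
def psi (p ε t : ℝ) : ℝ :=
  if t < ε ^ 2 then p / 2 * (t / ε ^ (2 - p)) + (1 - p / 2) * ε ^ p else t ^ (p / 2)

/-- `G_ε(w) = ∫_Ω ψ_ε(|w|²) dx`; in particular `G_0(w) = ∫_Ω |w|^p dx`. -/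
def G {d : ℕ} (Ω : Set (E d)) (p ε : ℝ) (w : L2 Ω) : ℝ :=
  ∫ x in Ω, psi p ε (|w x| ^ 2)

/-- `Φ_ε(u, w) = f(u) + α/2 ‖u‖_U² + β/2 ‖w‖_W² + γ G_ε(w)`, for `u ∈ U`, `w ∈ W`. -/
def Phi {d : ℕ} (κ : SpaceKind) (s T : ℝ) (Ω : Set (E d)) (f : U T Ω → ℝ) (α β γ p ε : ℝ)
    (u : U T Ω) (w : L2 Ω) : ℝ :=
  f u + α / 2 * ‖u‖ ^ 2 + β / 2 * (wNormSq κ s Ω w).toReal + γ * G Ω p ε w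

/-- The set `K` of all `(u, w) ∈ U × W` with `|u(t,x)| ≤ w(x)` for almost all `(t,x) ∈ I × Ω`. -/
def K {d : ℕ} (κ : SpaceKind) (s T : ℝ) (Ω : Set (E d)) : Set (U T Ω × L2 Ω) :=
  {q | q.2 ∈ W κ s Ω ∧ ∀ᵐ z ∂(cylMeasure T Ω), |q.1 z| ≤ q.2 z.2}

/-- `(ubar, wbar) ∈ K` minimizes `Φ_0` among all `(u, w) ∈ K` with `‖u - ubar‖_U ≤ ρ` and
`‖w - wbar‖_W ≤ ρ`. -/
def IsLocalSolution {d : ℕ} (κ : SpaceKind) (s T : ℝ) (Ω : Set (E d)) (f : U T Ω → ℝ)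
    (α β γ p ρ : ℝ) (ubar : U T Ω) (wbar : L2 Ω) : Prop :=
  (ubar, wbar) ∈ K κ s T Ω ∧
    ∀ (u : U T Ω) (w : L2 Ω), (u, w) ∈ K κ s T Ω → ‖u - ubar‖ ≤ ρ →
      wNorm κ s Ω (w - wbar) ≤ ENNReal.ofReal ρ →
      Phi κ s T Ω f α β γ p 0 ubar wbar ≤ Phi κ s T Ω f α β γ p 0 u w

/-- The objective of the smoothed, penalized and localized auxiliary problem:
`Φ_ε(u,w) + 1/2 ‖u - ubar‖_U² + 1/2 ‖w - wbar‖_{L²(Ω)}²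
  + 1/(2ε) ‖(w-u)₋‖_U² + 1/(2ε) ‖(w+u)₋‖_U²`, where `v₋ = min(v, 0)`. -/
def auxObjective {d : ℕ} (κ : SpaceKind) (s T : ℝ) (Ω : Set (E d)) (f : U T Ω → ℝ)
    (α β γ p : ℝ) (ubar : U T Ω) (wbar : L2 Ω) (ε : ℝ) (u : U T Ω) (w : L2 Ω) : ℝ :=
  Phi κ s T Ω f α β γ p ε u w + 1 / 2 * ‖u - ubar‖ ^ 2 + 1 / 2 * ‖w - wbar‖ ^ 2
    + 1 / (2 * ε) * ∫ z, (min (w z.2 - u z) 0) ^ 2 ∂(cylMeasure T Ω)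
    + 1 / (2 * ε) * ∫ z, (min (w z.2 + u z) 0) ^ 2 ∂(cylMeasure T Ω)

/-- The feasible set of the auxiliary problem: all `(u, w) ∈ U × W` with `‖u - ubar‖_U ≤ ρ` and
`‖w - wbar‖_W ≤ ρ`. -/
def auxFeasible {d : ℕ} (κ : SpaceKind) (s T : ℝ) (Ω : Set (E d)) (ρ : ℝ)
    (ubar : U T Ω) (wbar : L2 Ω) : Set (U T Ω × L2 Ω) :=
  {q | q.2 ∈ W κ s Ω ∧ ‖q.1 - ubar‖ ≤ ρ ∧ wNorm κ s Ω (q.2 - wbar) ≤ ENNReal.ofReal ρ}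

/-- `(u, w)` is a (global) solution of the auxiliary problem with parameter `ε`. -/
def IsAuxSolution {d : ℕ} (κ : SpaceKind) (s T : ℝ) (Ω : Set (E d)) (f : U T Ω → ℝ)
    (α β γ p ρ : ℝ) (ubar : U T Ω) (wbar : L2 Ω) (ε : ℝ) (u : U T Ω) (w : L2 Ω) : Prop :=
  (u, w) ∈ auxFeasible κ s T Ω ρ ubar wbar ∧
    ∀ (v : U T Ω) (z : L2 Ω), (v, z) ∈ auxFeasible κ s T Ω ρ ubar wbar →
      auxObjective κ s T Ω f α β γ p ubar wbar ε u w ≤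
        auxObjective κ s T Ω f α β γ p ubar wbar ε v z

end SparseFrac

end

noncomputable section

namespace SparseFrac

/-! ### Weak convergence in Hilbert spaces -/

section Weak

variable {H F : Type*} [NormedAddCommGroup H] [InnerProductSpace ℝ H]
  [NormedAddCommGroup F] [InnerProductSpace ℝ F]

/-! The point (ubar, wbar) is admissible for every auxiliary problem and has zero penalty there, and
the smoothing satisfies G_0 ≤ G_ε ≤ G_0 + ε^p |Ω|. Comparing (u_k, w_k) with it
(`IsAuxSolution.comparison`) bounds Φ_0(u_k, w_k) plus the tracking and penalty terms by Φ_0(ubar,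
wbar) + o(1). Since f has an affine minorant, the solutions stay bounded and the squared negative
parts are O(ε_k) (`aux_bounds`). After extraction, (u_k, w_k) converges weakly to some (us, ws).
This limit satisfies the constraint and lies in the ρ-ball, so Φ_0(ubar, wbar) ≤ Φ_0(us, ws).

Each quadratic term obeys ‖x_k‖² = ‖a‖² + ‖x_k - a‖² + o(1) along x_k ⇀ a, and f and G_0 are lower
semicontinuous along the sequence. All this combines to α/2 ‖u_k - us‖² + β/2 ‖w_k - ws‖_W² + 1/2
‖us - ubar‖² + 1/2 ‖ws - wbar‖² ≤ o(1). The last two terms identify the limit, the first two give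
strong convergence (`tendsto_of_weakConv`). The limit does not depend on the subsequence, so the
whole sequence converges.

Lower semicontinuity of G_0 needs strong convergence of w_k, but only in L² of subsets exhausting Ω:
|·|^p is subadditive and |ws|^p is integrable (`eventually_integral_abs_rpow_ge`).

The four spaces are treated at once through `SobolevModel`: W is the projection of a closed subspace
of L²(Ω) × H, the W-norm being θ‖w‖² + ‖h‖² under a root. For Gagliardo norms h is the weighted
difference quotient and θ = 1; local compactness holds because the seminorm controls the distance of
w to its averages over small balls (`gagliardoGraph_compact`). For the spectral norm θ = 0 and h has
the components μ^{s/2} P_μ w. There the inverse of 1 - Δ is compact by Rellich's theorem, so the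
eigenspaces span L²(Ω), and an Ehrling-type inequality gives compactness (`spectralGraph_compact`).
-/

/-- Weak convergence of a sequence in a real inner product space. -/
def WeakConv (x : ℕ → H) (a : H) : Prop :=
  ∀ v : H, Tendsto (fun n => ⟪x n, v⟫_ℝ) atTop (𝓝 ⟪a, v⟫_ℝ)

theorem WeakConv.comp {x : ℕ → H} {a : H} (h : WeakConv x a) {φ : ℕ → ℕ} (hφ : StrictMono φ) :
    WeakConv (x ∘ φ) a := fun v => (h v).comp hφ.tendsto_atTop

theorem WeakConv.sub {x y : ℕ → H} {a b : H} (hx : WeakConv x a) (hy : WeakConv y b) :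
    WeakConv (fun n => x n - y n) (a - b) := fun v => by
  simpa only [inner_sub_left] using (hx v).sub (hy v)

theorem WeakConv.add {x y : ℕ → H} {a b : H} (hx : WeakConv x a) (hy : WeakConv y b) :
    WeakConv (fun n => x n + y n) (a + b) := fun v => by
  simpa only [inner_add_left] using (hx v).add (hy v)

theorem WeakConv.sub_const {x : ℕ → H} {a : H} (hx : WeakConv x a) (b : H) :
    WeakConv (fun n => x n - b) (a - b) :=
  hx.sub fun _ => tendsto_const_nhds

theorem WeakConv.map [CompleteSpace H] [CompleteSpace F] {x : ℕ → H} {a : H} (h : WeakConv x a)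
    (L : H →L[ℝ] F) : WeakConv (fun n => L (x n)) (L a) := fun v => by
  simpa only [ContinuousLinearMap.adjoint_inner_right] using h (ContinuousLinearMap.adjoint L v)

/-- A closed subspace is its double orthogonal complement, and orthogonality to a fixed vector
survives weak limits. -/
theorem WeakConv.mem_of_isClosed [CompleteSpace H] {x : ℕ → H} {a : H} (h : WeakConv x a)
    {S : Submodule ℝ H} (hS : IsClosed (S : Set H)) (hx : ∀ n, x n ∈ S) : a ∈ S := by
  have : CompleteSpace S := hS.completeSpace_coe
  rw [← S.orthogonal_orthogonal, Submodule.mem_orthogonal']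
  intro v hv
  refine tendsto_nhds_unique (h v) ?_
  simp only [fun n => (Submodule.mem_orthogonal S v).1 hv (x n) (hx n)]
  exact tendsto_const_nhds

/-- The difference equals 2⟪x_n, a⟫ - ‖a‖², which is affine in x_n. Unlike mere lower semicontinuity
of the norm, this keeps the defect ‖x_n - a‖², from which strong convergence is obtained later. -/
theorem WeakConv.norm_sq_sub {x : ℕ → H} {a : H} (h : WeakConv x a) :
    Tendsto (fun n => ‖x n‖ ^ 2 - ‖x n - a‖ ^ 2) atTop (𝓝 (‖a‖ ^ 2)) := by
  have h1 : Tendsto (fun n => 2 * ⟪x n, a⟫_ℝ - ‖a‖ ^ 2) atTop (𝓝 (2 * ⟪a, a⟫_ℝ - ‖a‖ ^ 2)) :=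
    ((h a).const_mul 2).sub_const _
  rw [real_inner_self_eq_norm_sq] at h1
  convert h1 using 2 with n
  · rw [norm_sub_sq_real]; ring
  · ring

theorem WeakConv.norm_sq_le {x : ℕ → H} {a : H} (h : WeakConv x a) {C : ℝ}
    (hC : ∀ n, ‖x n‖ ^ 2 ≤ C) : ‖a‖ ^ 2 ≤ C :=
  le_of_tendsto h.norm_sq_sub (Eventually.of_forall fun n => by
    linarith [hC n, sq_nonneg ‖x n - a‖])

/-- Sequential Banach–Alaoglu in the separable case, transported by the Riesz isometry. -/
theorem exists_weakConv_subseq [CompleteSpace H] [SecondCountableTopology H] {x : ℕ → H} {C : ℝ}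
    (hC : ∀ n, ‖x n‖ ≤ C) : ∃ (a : H) (φ : ℕ → ℕ), StrictMono φ ∧ WeakConv (x ∘ φ) a := by
  have hseq := WeakDual.isSeqCompact_closedBall ℝ H (0 : StrongDual ℝ H) C
  have hmem : ∀ n, StrongDual.toWeakDual (InnerProductSpace.toDual ℝ H (x n)) ∈
      WeakDual.toStrongDual ⁻¹' Metric.closedBall (0 : StrongDual ℝ H) C := by
    intro n
    simpa using hC n
  obtain ⟨l, -, φ, hφ, hl⟩ := hseq hmem
  refine ⟨(InnerProductSpace.toDual ℝ H).symm (WeakDual.toStrongDual l), φ, hφ, fun v => ?_⟩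
  have := ((WeakDual.eval_continuous v).tendsto l).comp hl
  simpa [Function.comp_def] using this

/-- The image of the closed unit ball is itself sequentially compact: the ball is weakly closed, and
`hL` applies to a weakly convergent subsequence minus its limit, which is bounded by 2. -/
theorem isCompactOperator_of_weakConv [CompleteSpace H] [SecondCountableTopology H]
    (L : H →L[ℝ] F) (hL : ∀ (x : ℕ → H) (C : ℝ), (∀ n, ‖x n‖ ≤ C) → WeakConv x 0 →
      Tendsto (fun n => L (x n)) atTop (𝓝 0)) : IsCompactOperator L := by
  refine isCompactOperator_iff_exists_mem_nhds_image_subset_compact L |>.2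
    ⟨Metric.closedBall 0 1, Metric.closedBall_mem_nhds _ one_pos, L '' Metric.closedBall 0 1, ?_,
      Subset.rfl⟩
  refine IsSeqCompact.isCompact fun y hy => ?_
  choose x hx hxy using hy
  have hx1 : ∀ n, ‖x n‖ ≤ 1 := fun n => by simpa using hx n
  obtain ⟨a, φ, hφ, ha⟩ := exists_weakConv_subseq hx1
  have ha1 : ‖a‖ ≤ 1 := by
    have := ha.norm_sq_le (C := 1) fun n => by
      have := hx1 (φ n); simp only [Function.comp]; nlinarith [norm_nonneg (x (φ n))]
    nlinarith [norm_nonneg a]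
  refine ⟨L a, ⟨a, by simpa using ha1, rfl⟩, φ, hφ, ?_⟩
  have hw : WeakConv (fun n => x (φ n) - a) 0 := by simpa using ha.sub_const a
  have := hL _ 2 (fun n => (norm_sub_le _ _).trans (by linarith [hx1 (φ n)])) hw
  simp only [map_sub] at this
  have h2 := this.add_const (L a)
  simpa [hxy, Function.comp_def] using h2

end Weak

/-! ### The sparsity functional and its smoothing -/

theorem psi_zero_sq {p : ℝ} (x : ℝ) : psi p 0 (|x| ^ 2) = |x| ^ p := by
  have h : ¬ |x| ^ 2 < (0 : ℝ) ^ 2 := by simp [sq_nonneg]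
  rw [psi, if_neg h, ← Real.rpow_natCast, ← Real.rpow_mul (abs_nonneg x)]
  congr 1
  push_cast
  ring

/-- Below ε² the function ψ_ε is the tangent at ε² of the concave function t^{p/2}. The inequality
is weighted AM–GM for t and ε² with weights p/2 and 1 - p/2, divided by ε^{2-p}. -/
theorem rpow_le_psi {p ε t : ℝ} (hp : p ∈ Ioo (0 : ℝ) 1) (hε : 0 < ε) (ht : 0 ≤ t) :
    t ^ (p / 2) ≤ psi p ε t := by
  unfold psi
  split_ifs with h
  · have key := Real.geom_mean_le_arith_mean2_weighted (w₁ := p / 2) (w₂ := 1 - p / 2)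
      (by linarith [hp.1]) (by linarith [hp.2]) ht (sq_nonneg ε) (by ring)
    have e1 : (ε ^ 2) ^ (1 - p / 2) = ε ^ (2 - p) := by
      rw [← Real.rpow_natCast, ← Real.rpow_mul hε.le]; congr 1; push_cast; ring
    have e2 : ε ^ 2 = ε ^ p * ε ^ (2 - p) := by
      rw [← Real.rpow_add hε, ← Real.rpow_natCast]; congr 1; push_cast; ring
    rw [e1] at key
    have hpos : 0 < ε ^ (2 - p) := Real.rpow_pos_of_pos hε _
    rw [← mul_le_mul_iff_left₀ hpos]
    refine key.trans (le_of_eq ?_)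
    rw [e2]
    field_simp
  · exact le_rfl

/-- Below ε² the tangent is increasing and takes the value ε^p at ε². -/
theorem psi_le {p ε t : ℝ} (hp : p ∈ Ioo (0 : ℝ) 1) (hε : 0 < ε) (ht : 0 ≤ t) :
    psi p ε t ≤ t ^ (p / 2) + ε ^ p := by
  have h0 : 0 ≤ t ^ (p / 2) := Real.rpow_nonneg ht _
  have h1 : 0 < ε ^ p := Real.rpow_pos_of_pos hε _
  unfold psi
  split_ifs with h
  · have hpos : 0 < ε ^ (2 - p) := Real.rpow_pos_of_pos hε _
    have e2 : ε ^ 2 = ε ^ p * ε ^ (2 - p) := by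
      rw [← Real.rpow_add hε, ← Real.rpow_natCast]; congr 1; push_cast; ring
    have : t / ε ^ (2 - p) ≤ ε ^ p := by
      rw [div_le_iff₀ hpos, ← e2]; exact h.le
    nlinarith [hp.1]
  · linarith

theorem measurable_psi (p ε : ℝ) : Measurable (psi p ε) := by
  unfold psi
  refine Measurable.ite measurableSet_Iio ?_ ?_ <;> fun_prop

/-- For t ≥ η write t^p = t^{p-2} t² and use p - 2 < 0. The first term is made small by η; for fixed
η the second is controlled by L² convergence. -/
theorem rpow_le_add_mul_sq {p η t : ℝ} (hp : p ∈ Ioo (0 : ℝ) 1) (hη : 0 < η) (ht : 0 ≤ t) :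
    t ^ p ≤ η ^ p + η ^ (p - 2) * t ^ 2 := by
  have h2 : 0 ≤ η ^ (p - 2) * t ^ 2 := mul_nonneg (Real.rpow_nonneg hη.le _) (sq_nonneg t)
  rcases le_total t η with h | h
  · linarith [Real.rpow_le_rpow ht h hp.1.le]
  · have htp : 0 < t := hη.trans_le h
    have e : t ^ p = t ^ (p - 2) * t ^ 2 := by
      rw [← Real.rpow_natCast, ← Real.rpow_add htp]; congr 1; push_cast; ring
    have := Real.rpow_le_rpow_of_nonpos hη h (by linarith [hp.2] : p - 2 ≤ 0)
    have h3 : 0 ≤ η ^ p := Real.rpow_nonneg hη.le _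
    rw [e]
    nlinarith [sq_nonneg t]

section Lsc

variable {α : Type*} [MeasurableSpace α] {μ : Measure α}

theorem integrable_sq (w : Lp ℝ 2 μ) : Integrable (fun x => (w x) ^ 2) μ :=
  (Lp.memLp w).integrable_sq

theorem Lp_norm_sq (w : Lp ℝ 2 μ) : ‖w‖ ^ 2 = ∫ x, (w x) ^ 2 ∂μ := by
  rw [← real_inner_self_eq_norm_sq, L2.inner_def]
  simp [sq]

theorem Lp_norm_sq_eq_lintegral (w : Lp ℝ 2 μ) :
    ENNReal.ofReal (‖w‖ ^ 2) = ∫⁻ x, ENNReal.ofReal ((w x) ^ 2) ∂μ := by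
  rw [Lp_norm_sq, ofReal_integral_eq_lintegral_ofReal (integrable_sq w)
    (Eventually.of_forall fun x => sq_nonneg _)]

variable [IsFiniteMeasure μ]

theorem integrable_abs_rpow {p : ℝ} (hp : p ∈ Ioo (0 : ℝ) 1) (w : Lp ℝ 2 μ) :
    Integrable (fun x => |w x| ^ p) μ := by
  refine Integrable.mono' ((integrable_const (1 : ℝ)).add (integrable_sq w))
    ((Lp.aestronglyMeasurable w).aemeasurable.abs.pow_const p).aestronglyMeasurable
    (Eventually.of_forall fun x => ?_)
  have := rpow_le_add_mul_sq hp one_pos (abs_nonneg (w x))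
  rw [Real.norm_of_nonneg (Real.rpow_nonneg (abs_nonneg _) _)]
  simpa using this

/-- On S_m subadditivity gives |a|^p ≤ |w_n|^p + |w_n - a|^p. Outside S_m the integral of |a|^p is
small and that of |w_n|^p only helps, so L² convergence on each S_m suffices. -/
theorem eventually_integral_abs_rpow_ge {p : ℝ} (hp : p ∈ Ioo (0 : ℝ) 1) {S : ℕ → Set α}
    (hS : ∀ m, MeasurableSet (S m)) (hmono : Monotone S) (hU : ∀ᵐ x ∂μ, x ∈ ⋃ m, S m)
    {w : ℕ → Lp ℝ 2 μ} {a : Lp ℝ 2 μ}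
    (h : ∀ m, Tendsto (fun n => ∫ x in S m, ((w n - a : Lp ℝ 2 μ) x) ^ 2 ∂μ) atTop (𝓝 0))
    {δ : ℝ} (hδ : 0 < δ) :
    ∀ᶠ n in atTop, ∫ x, |a x| ^ p ∂μ - δ ≤ ∫ x, |w n x| ^ p ∂μ := by
  have hlim : Tendsto (fun m => ∫ x in S m, |a x| ^ p ∂μ) atTop (𝓝 (∫ x, |a x| ^ p ∂μ)) := by
    have := tendsto_setIntegral_of_monotone hS hmono (integrable_abs_rpow hp a).integrableOn
    rwa [setIntegral_eq_integral_of_ae_compl_eq_zero] at this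
    filter_upwards [hU] with x hx hx' using absurd hx hx'
  obtain ⟨m, hm⟩ := (hlim.eventually (lt_mem_nhds (by linarith :
    ∫ x, |a x| ^ p ∂μ - δ / 3 < ∫ x, |a x| ^ p ∂μ))).exists
  -- The loss δ is split in three: the part of |a|^p outside S_m, the constant η^p, and the term
  -- with η^{p-2}, which is made small last, by taking n large with m and η fixed.
  obtain ⟨η, hη, hηδ⟩ : ∃ η : ℝ, 0 < η ∧ η ^ p * μ.real univ ≤ δ / 3 := by
    have : Tendsto (fun η : ℝ => η ^ p * μ.real univ) (𝓝[>] 0) (𝓝 0) := by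
      have h1 := ((Real.continuousAt_rpow_const 0 p (Or.inr hp.1.le)).tendsto.mul_const
        (μ.real univ)).mono_left (nhdsWithin_le_nhds (s := Ioi 0))
      simpa [Real.zero_rpow hp.1.ne'] using h1
    obtain ⟨η, h1, h2⟩ := ((this.eventually (gt_mem_nhds (by linarith : (0 : ℝ) < δ / 3))).and
      self_mem_nhdsWithin).exists
    exact ⟨η, h2, h1.le⟩
  have hη2 := (h m).const_mul (η ^ (p - 2))
  rw [mul_zero] at hη2
  filter_upwards [hη2.eventually (gt_mem_nhds (by linarith : (0 : ℝ) < δ / 3))] with n hn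
  set v : Lp ℝ 2 μ := w n - a
  have hle : ∫ x in S m, |a x| ^ p ∂μ ≤
      ∫ x in S m, (|w n x| ^ p + (η ^ p + η ^ (p - 2) * (v x) ^ 2)) ∂μ := by
    refine integral_mono_ae (integrable_abs_rpow hp a).integrableOn ?_ ?_
    · exact ((integrable_abs_rpow hp (w n)).add
        ((integrable_const _).add ((integrable_sq v).const_mul _))).integrableOn
    · refine ae_restrict_of_ae ?_
      filter_upwards [Lp.coeFn_sub (w n) a] with x hx
      have e : |a x| ≤ |w n x| + |v x| := by
        have : v x = w n x - a x := hx
        rw [this]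
        calc |a x| = |w n x - (w n x - a x)| := by ring_nf
          _ ≤ _ := abs_sub _ _
      calc |a x| ^ p ≤ (|w n x| + |v x|) ^ p := Real.rpow_le_rpow (abs_nonneg _) e hp.1.le
        _ ≤ |w n x| ^ p + |v x| ^ p :=
          Real.rpow_add_le_add_rpow (abs_nonneg _) (abs_nonneg _) hp.1.le hp.2.le
        _ ≤ _ := by
          have := rpow_le_add_mul_sq hp hη (abs_nonneg (v x))
          rw [sq_abs] at this
          linarith
  have hI : Integrable (fun x => η ^ p + η ^ (p - 2) * (v x) ^ 2) μ :=
    (integrable_const _).add ((integrable_sq v).const_mul _)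
  rw [integral_add (integrable_abs_rpow hp (w n)).integrableOn hI.integrableOn,
    integral_add (integrable_const _) ((integrable_sq v).const_mul _).integrableOn,
    integral_const_mul, setIntegral_const, smul_eq_mul] at hle
  have h4 : ∫ x in S m, |w n x| ^ p ∂μ ≤ ∫ x, |w n x| ^ p ∂μ :=
    setIntegral_le_integral (integrable_abs_rpow hp (w n))
      (Eventually.of_forall fun x => Real.rpow_nonneg (abs_nonneg _) _)
  have h5 : μ.real (S m) * η ^ p ≤ η ^ p * μ.real univ := by
    rw [mul_comm]
    exact mul_le_mul_of_nonneg_left (measureReal_mono (subset_univ _)) (Real.rpow_nonneg hη.le _)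
  linarith

end Lsc

section GBounds

variable {d : ℕ} {Ω : Set (E d)} {p : ℝ}

theorem G_zero (w : L2 Ω) : G Ω p 0 w = ∫ x in Ω, |w x| ^ p := by
  simp only [G, psi_zero_sq]

theorem G_zero_nonneg (w : L2 Ω) : 0 ≤ G Ω p 0 w := by
  rw [G_zero]
  exact integral_nonneg fun x => Real.rpow_nonneg (abs_nonneg _) _

variable [IsFiniteMeasure (volume.restrict Ω)]

theorem abs_rpow_le_psi {ε : ℝ} (hp : p ∈ Ioo (0 : ℝ) 1) (hε : 0 < ε) (x : ℝ) :
    |x| ^ p ≤ psi p ε (|x| ^ 2) := by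
  have := rpow_le_psi hp hε (sq_nonneg |x|)
  rwa [← Real.rpow_natCast, ← Real.rpow_mul (abs_nonneg x), show ((2 : ℕ) : ℝ) * (p / 2) = p by
    push_cast; ring, Real.rpow_natCast] at this

theorem psi_le_abs_rpow {ε : ℝ} (hp : p ∈ Ioo (0 : ℝ) 1) (hε : 0 < ε) (x : ℝ) :
    psi p ε (|x| ^ 2) ≤ |x| ^ p + ε ^ p := by
  have := psi_le hp hε (sq_nonneg |x|)
  rwa [← Real.rpow_natCast, ← Real.rpow_mul (abs_nonneg x), show ((2 : ℕ) : ℝ) * (p / 2) = p by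
    push_cast; ring, Real.rpow_natCast] at this

theorem integrable_psi {ε : ℝ} (hp : p ∈ Ioo (0 : ℝ) 1) (hε : 0 < ε) (w : L2 Ω) :
    Integrable (fun x => psi p ε (|w x| ^ 2)) (volume.restrict Ω) := by
  refine Integrable.mono' ((integrable_abs_rpow hp w).add (integrable_const (ε ^ p)))
    ((measurable_psi p ε).comp_aemeasurable
      ((Lp.aestronglyMeasurable w).aemeasurable.abs.pow_const 2)).aestronglyMeasurable
    (Eventually.of_forall fun x => ?_)
  rw [Real.norm_of_nonneg ((Real.rpow_nonneg (abs_nonneg _) _).trans (abs_rpow_le_psi hp hε _))]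
  exact psi_le_abs_rpow hp hε _

theorem G_zero_le {ε : ℝ} (hp : p ∈ Ioo (0 : ℝ) 1) (hε : 0 < ε) (w : L2 Ω) :
    G Ω p 0 w ≤ G Ω p ε w := by
  rw [G_zero]
  exact integral_mono (integrable_abs_rpow hp w) (integrable_psi hp hε w)
    fun x => abs_rpow_le_psi hp hε _

theorem G_le {ε : ℝ} (hp : p ∈ Ioo (0 : ℝ) 1) (hε : 0 < ε) (w : L2 Ω) :
    G Ω p ε w ≤ G Ω p 0 w + ε ^ p * (volume.restrict Ω).real univ := by
  rw [G_zero]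
  refine (integral_mono (integrable_psi hp hε w)
    ((integrable_abs_rpow hp w).add (integrable_const (ε ^ p)))
    fun x => psi_le_abs_rpow hp hε _).trans (le_of_eq ?_)
  simp only [Pi.add_apply]
  rw [integral_add (integrable_abs_rpow hp w) (integrable_const _), integral_const, smul_eq_mul,
    mul_comm]

end GBounds

/-! ### The cylinder and the constraint -/

instance {d : ℕ} (T : ℝ) (Ω : Set (E d)) : SFinite (cylMeasure T Ω) := by
  unfold cylMeasure; infer_instance

section Cylinder

variable {d : ℕ} {T : ℝ} {Ω : Set (E d)}

theorem memLp_comp_snd_cyl (w : L2 Ω) :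
    MemLp (fun z : ℝ × E d => w z.2) 2 (cylMeasure T Ω) :=
  (Lp.memLp w).comp_snd _

theorem ae_cyl_of_ae {q : E d → Prop} (h : ∀ᵐ x ∂(volume.restrict Ω), q x) :
    ∀ᵐ z ∂(cylMeasure T Ω), q z.2 :=
  Measure.quasiMeasurePreserving_snd.ae h

/-- The extension `w(t, x) = w(x)` of functions on `Ω` to the cylinder. -/
def extCyl (T : ℝ) (Ω : Set (E d)) : L2 Ω →L[ℝ] U T Ω :=
  LinearMap.mkContinuous
    { toFun := fun w => (memLp_comp_snd_cyl w).toLp _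
      map_add' := fun v w => by
        rw [← MemLp.toLp_add]
        refine MemLp.toLp_congr _ _ ?_
        exact ae_cyl_of_ae (q := fun x => (v + w : L2 Ω) x = v x + w x) (Lp.coeFn_add v w)
      map_smul' := fun c w => by
        rw [RingHom.id_apply, ← MemLp.toLp_const_smul]
        refine MemLp.toLp_congr _ _ ?_
        exact ae_cyl_of_ae (q := fun x => (c • w : L2 Ω) x = c • w x) (Lp.coeFn_smul c w) }
    -- By Fubini the extension multiplies norms by exactly the square root of the length of the time
    -- interval.
    √((volume.restrict (Ioo (0 : ℝ) T)).real univ) fun w => by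
      have h : ‖(memLp_comp_snd_cyl (T := T) w).toLp _‖ ^ 2 =
          (volume.restrict (Ioo (0 : ℝ) T)).real univ * ‖w‖ ^ 2 := by
        rw [Lp_norm_sq, Lp_norm_sq, integral_congr_ae (g := fun z : ℝ × E d => (w z.2) ^ 2)
          (by filter_upwards [(memLp_comp_snd_cyl (T := T) w).coeFn_toLp] with z hz; rw [hz])]
        have := integral_prod_mul (μ := volume.restrict (Ioo (0 : ℝ) T))
          (ν := volume.restrict Ω) (fun _ => (1 : ℝ)) (fun x => (w x) ^ 2)
        simpa [cylMeasure] using this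
      refine le_of_sq_le_sq ?_ (by positivity)
      change ‖(memLp_comp_snd_cyl (T := T) w).toLp _‖ ^ 2 ≤ _
      rw [h, mul_pow, Real.sq_sqrt measureReal_nonneg]

theorem extCyl_coeFn (w : L2 Ω) : extCyl T Ω w =ᵐ[cylMeasure T Ω] fun z => w z.2 :=
  (memLp_comp_snd_cyl w).coeFn_toLp

end Cylinder

/-- A weak limit of functions whose negative parts tend to zero in `L²` is nonnegative. -/
theorem WeakConv.ae_nonneg {α : Type*} [MeasurableSpace α] {μ : Measure α} {v : ℕ → Lp ℝ 2 μ}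
    {a : Lp ℝ 2 μ} (hv : WeakConv v a)
    (h : Tendsto (fun n => ∫ z, (min (v n z) 0) ^ 2 ∂μ) atTop (𝓝 0)) : ∀ᵐ z ∂μ, 0 ≤ a z := by
  have hneg : ∀ b : Lp ℝ 2 μ, MemLp (fun z => min (b z) 0) 2 μ := fun b =>
    (Lp.memLp b).inf MemLp.zero
  let m : Lp ℝ 2 μ → Lp ℝ 2 μ := fun b => (hneg b).toLp _
  have hm : ∀ b, m b =ᵐ[μ] fun z => min (b z) 0 := fun b => (hneg b).coeFn_toLp
  have hnorm : ∀ b, ‖m b‖ ^ 2 = ∫ z, (min (b z) 0) ^ 2 ∂μ := fun b => by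
    rw [Lp_norm_sq]
    exact integral_congr_ae (by filter_upwards [hm b] with z hz; rw [hz])
  have h0 : Tendsto (fun n => ‖m (v n)‖) atTop (𝓝 0) := by
    have := (Real.continuous_sqrt.tendsto 0).comp h
    simp only [Real.sqrt_zero] at this
    refine this.congr fun n => ?_
    simp only [Function.comp, ← hnorm, Real.sqrt_sq (norm_nonneg _)]
  -- Since v ≥ v₋ and a₋ ≤ 0, the product v a₋ is at most v₋ a₋. In the limit ‖a₋‖² = ⟪a, a₋⟫ ≤ 0.
  have h1 : ∀ n, ⟪v n, m a⟫_ℝ ≤ ‖m (v n)‖ * ‖m a‖ := fun n => by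
    refine le_trans ?_ (real_inner_le_norm _ _)
    rw [L2.inner_def, L2.inner_def]
    refine integral_mono_ae (L2.integrable_inner _ _) (L2.integrable_inner _ _) ?_
    filter_upwards [hm (v n), hm a] with z hz hz'
    simp only [hz, hz', Real.inner_apply]
    nlinarith [min_le_left (v n z) 0, min_le_right (a z) 0]
  have h2 : ⟪a, m a⟫_ℝ ≤ 0 := by
    have := h0.mul_const ‖m a‖
    rw [zero_mul] at this
    exact le_of_tendsto_of_tendsto' (hv (m a)) this h1
  have h3 : ⟪a, m a⟫_ℝ = ‖m a‖ ^ 2 := by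
    rw [L2.inner_def, hnorm]
    refine integral_congr_ae ?_
    filter_upwards [hm a] with z hz
    simp only [hz, Real.inner_apply]
    rcases le_total (a z) 0 with h | h
    · rw [min_eq_left h]; ring
    · rw [min_eq_right h]; ring
  have h4 : m a = 0 := by
    rw [← norm_eq_zero]; nlinarith [norm_nonneg (m a)]
  filter_upwards [hm a, Lp.coeFn_zero ℝ 2 μ] with z hz hz'
  rw [h4, hz'] at hz
  simpa using hz.le

/-! ### Hilbert space models of the fractional Sobolev spaces -/

/-- The points of `Ω` at distance at least `r` from the complement. -/
def innerSet {d : ℕ} (Ω : Set (E d)) (r : ℝ) : Set (E d) := {x | Metric.ball x r ⊆ Ω}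

theorem innerSet_subset {d : ℕ} {Ω : Set (E d)} {r : ℝ} (hr : 0 < r) : innerSet Ω r ⊆ Ω :=
  fun _ hx => hx (Metric.mem_ball_self hr)

theorem isClosed_innerSet {d : ℕ} (Ω : Set (E d)) (r : ℝ) : IsClosed (innerSet Ω r) := by
  rw [← isOpen_compl_iff, Metric.isOpen_iff]
  intro x hx
  obtain ⟨y, hy, hyΩ⟩ := not_subset.1 (show ¬ Metric.ball x r ⊆ Ω from hx)
  refine ⟨r - dist y x, sub_pos.2 hy, fun z hz hz' => hyΩ (hz' ?_)⟩
  rw [Metric.mem_ball] at hz ⊢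
  have := dist_triangle y x z
  rw [dist_comm z x] at hz
  linarith

theorem monotone_innerSet {d : ℕ} (Ω : Set (E d)) :
    Monotone fun m : ℕ => innerSet Ω (1 / ((m : ℝ) + 1)) := fun m n hmn _ hx =>
  (Metric.ball_subset_ball (one_div_le_one_div_of_le (by positivity)
    (by exact_mod_cast Nat.succ_le_succ hmn))).trans hx

theorem iUnion_innerSet {d : ℕ} {Ω : Set (E d)} (hΩ : IsOpen Ω) :
    Ω ⊆ ⋃ m : ℕ, innerSet Ω (1 / ((m : ℝ) + 1)) := fun x hx => by
  obtain ⟨r, hr, hrΩ⟩ := Metric.isOpen_iff.1 hΩ x hx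
  obtain ⟨m, hm⟩ := exists_nat_one_div_lt hr
  exact mem_iUnion.2 ⟨m, (Metric.ball_subset_ball hm.le).trans hrΩ⟩

/-- A description of the space `W` by a closed subspace `graph` of `L²(Ω) × H`, where `H` is a
Hilbert space, such that the `W`-norm of `w` is read off from the pair `(w, h)` in `graph`, and such
that bounded weakly convergent sequences in `graph` converge locally in `L²`. -/
structure SobolevModel {d : ℕ} (κ : SpaceKind) (s : ℝ) (Ω : Set (E d)) (H : Type)
    [NormedAddCommGroup H] [InnerProductSpace ℝ H] where
  θ : ℝ
  θ_nonneg : 0 ≤ θ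
  graph : Submodule ℝ (WithLp 2 (L2 Ω × H))
  isClosed : IsClosed (graph : Set (WithLp 2 (L2 Ω × H)))
  mem_W : ∀ w, w ∈ W κ s Ω ↔ ∃ x ∈ graph, x.fst = w
  normSq : ∀ x ∈ graph, wNormSq κ s Ω x.fst = ENNReal.ofReal (θ * ‖x.fst‖ ^ 2 + ‖x.snd‖ ^ 2)
  compact : ∀ (x : ℕ → WithLp 2 (L2 Ω × H)) (C : ℝ), (∀ n, x n ∈ graph) → (∀ n, ‖x n‖ ≤ C) →
    WeakConv x 0 → ∀ r : ℝ, 0 < r →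
      Tendsto (fun n => ∫ z in innerSet Ω r, ((x n).fst z) ^ 2 ∂(volume.restrict Ω)) atTop (𝓝 0)

namespace SobolevModel

variable {d : ℕ} {κ : SpaceKind} {s : ℝ} {Ω : Set (E d)} {H : Type} [NormedAddCommGroup H]
  [InnerProductSpace ℝ H] (M : SobolevModel κ s Ω H)

/-- The quadratic form on `L²(Ω) × H` that restricts to the squared `W`-norm. -/
def quad (x : WithLp 2 (L2 Ω × H)) : ℝ := M.θ * ‖x.fst‖ ^ 2 + ‖x.snd‖ ^ 2

theorem quad_nonneg (x : WithLp 2 (L2 Ω × H)) : 0 ≤ M.quad x :=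
  add_nonneg (mul_nonneg M.θ_nonneg (sq_nonneg _)) (sq_nonneg _)

theorem toReal_normSq {x : WithLp 2 (L2 Ω × H)} (hx : x ∈ M.graph) :
    (wNormSq κ s Ω x.fst).toReal = M.quad x := by
  rw [M.normSq x hx]
  exact ENNReal.toReal_ofReal (M.quad_nonneg x)

theorem wNorm_eq {x : WithLp 2 (L2 Ω × H)} (hx : x ∈ M.graph) :
    wNorm κ s Ω x.fst = ENNReal.ofReal √(M.quad x) := by
  rw [wNorm, M.normSq x hx, Real.sqrt_eq_rpow]
  exact ENNReal.ofReal_rpow_of_nonneg (M.quad_nonneg x) (by norm_num)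

theorem wNorm_le_iff {x : WithLp 2 (L2 Ω × H)} (hx : x ∈ M.graph) {ρ : ℝ} (hρ : 0 ≤ ρ) :
    wNorm κ s Ω x.fst ≤ ENNReal.ofReal ρ ↔ M.quad x ≤ ρ ^ 2 := by
  rw [M.wNorm_eq hx, ENNReal.ofReal_le_ofReal_iff hρ, Real.sqrt_le_left hρ]

theorem tendsto_quad_sub [CompleteSpace H] {x : ℕ → WithLp 2 (L2 Ω × H)} {a : WithLp 2 (L2 Ω × H)}
    (h : WeakConv x a) :
    Tendsto (fun n => M.quad (x n) - M.quad (x n - a)) atTop (𝓝 (M.quad a)) := by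
  have h1 := (h.map (WithLp.fstL 2 ℝ (L2 Ω) H)).norm_sq_sub
  have h2 := (h.map (WithLp.sndL 2 ℝ (L2 Ω) H)).norm_sq_sub
  refine ((h1.const_mul M.θ).add h2).congr fun n => ?_
  simp only [quad, WithLp.fstL_apply, WithLp.sndL_apply, WithLp.sub_fst, WithLp.sub_snd]
  ring

end SobolevModel

/-! ### Convergence of the solutions of the auxiliary problems -/

section Convergence

variable {d : ℕ} {κ : SpaceKind} {s T : ℝ} {Ω : Set (E d)} {H : Type} [NormedAddCommGroup H]
  [InnerProductSpace ℝ H] {f : U T Ω → ℝ} {α β γ p ρ : ℝ} {ubar : U T Ω}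

theorem integral_neg_part_eq_zero {u : U T Ω} {w : L2 Ω}
    (h : ∀ᵐ z ∂(cylMeasure T Ω), |u z| ≤ w z.2) :
    ∫ z, (min (w z.2 - u z) 0) ^ 2 ∂(cylMeasure T Ω) = 0 ∧
      ∫ z, (min (w z.2 + u z) 0) ^ 2 ∂(cylMeasure T Ω) = 0 := by
  constructor
  · refine integral_eq_zero_of_ae ?_
    filter_upwards [h] with z hz
    have := abs_le.1 hz
    simp [min_eq_right (by linarith : (0 : ℝ) ≤ w z.2 - u z)]
  · refine integral_eq_zero_of_ae ?_
    filter_upwards [h] with z hz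
    have := abs_le.1 hz
    simp [min_eq_right (by linarith : (0 : ℝ) ≤ w z.2 + u z)]

/-- Weak limits of pairs with vanishing penalties satisfy the constraint. -/
theorem abs_le_of_weakConv {u : ℕ → U T Ω} {w : ℕ → L2 Ω} {us : U T Ω} {ws : L2 Ω}
    (hu : WeakConv u us) (hw : WeakConv w ws)
    (hA : Tendsto (fun k => ∫ z, (min (w k z.2 - u k z) 0) ^ 2 ∂(cylMeasure T Ω)) atTop (𝓝 0))
    (hB : Tendsto (fun k => ∫ z, (min (w k z.2 + u k z) 0) ^ 2 ∂(cylMeasure T Ω)) atTop (𝓝 0)) :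
    ∀ᵐ z ∂(cylMeasure T Ω), |us z| ≤ ws z.2 := by
  have hE := hw.map (extCyl T Ω)
  have h1 := (hE.sub hu).ae_nonneg (hA.congr fun k => integral_congr_ae (by
    filter_upwards [Lp.coeFn_sub (extCyl T Ω (w k)) (u k), extCyl_coeFn (T := T) (w k)]
      with z h1 h2
    rw [h1, Pi.sub_apply, h2]))
  have h2 := (hE.add hu).ae_nonneg (hB.congr fun k => integral_congr_ae (by
    filter_upwards [Lp.coeFn_add (extCyl T Ω (w k)) (u k), extCyl_coeFn (T := T) (w k)]
      with z h1 h2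
    rw [h1, Pi.add_apply, h2]))
  filter_upwards [h1, h2, Lp.coeFn_sub (extCyl T Ω ws) us, Lp.coeFn_add (extCyl T Ω ws) us,
    extCyl_coeFn (T := T) ws] with z h1 h2 h3 h4 h5
  rw [h3, Pi.sub_apply, h5] at h1
  rw [h4, Pi.add_apply, h5] at h2
  exact abs_le.2 ⟨by linarith, by linarith⟩

variable [IsFiniteMeasure (volume.restrict Ω)]

/-- The comparison of a solution of the auxiliary problem with `(ubar, wbar)`. -/
theorem IsAuxSolution.comparison (M : SobolevModel κ s Ω H) {ε : ℝ} (hε : 0 < ε)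
    (hγ : 0 < γ) (hp : p ∈ Ioo (0 : ℝ) 1) (hρ : 0 < ρ) {xb : WithLp 2 (L2 Ω × H)}
    (hxb : xb ∈ M.graph) (hK : ∀ᵐ z ∂(cylMeasure T Ω), |ubar z| ≤ xb.fst z.2)
    {u : U T Ω} {x : WithLp 2 (L2 Ω × H)} (hx : x ∈ M.graph)
    (h : IsAuxSolution κ s T Ω f α β γ p ρ ubar xb.fst ε u x.fst) :
    f u + α / 2 * ‖u‖ ^ 2 + β / 2 * M.quad x + γ * G Ω p 0 x.fst
        + 1 / 2 * ‖u - ubar‖ ^ 2 + 1 / 2 * ‖x.fst - xb.fst‖ ^ 2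
        + 1 / (2 * ε) * ∫ z, (min (x.fst z.2 - u z) 0) ^ 2 ∂(cylMeasure T Ω)
        + 1 / (2 * ε) * ∫ z, (min (x.fst z.2 + u z) 0) ^ 2 ∂(cylMeasure T Ω)
      ≤ f ubar + α / 2 * ‖ubar‖ ^ 2 + β / 2 * M.quad xb
        + γ * (G Ω p 0 xb.fst + ε ^ p * (volume.restrict Ω).real univ) := by
  have hfeas : (ubar, xb.fst) ∈ auxFeasible κ s T Ω ρ ubar xb.fst := by
    refine ⟨(M.mem_W _).2 ⟨xb, hxb, rfl⟩, by simpa using hρ.le, ?_⟩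
    have h0 := (M.wNorm_le_iff (sub_mem hxb hxb) hρ.le).2
      (by simp [SobolevModel.quad, sq_nonneg])
    simpa using h0
  have h1 := h.2 _ _ hfeas
  obtain ⟨hA, hB⟩ := integral_neg_part_eq_zero hK
  simp only [auxObjective, Phi, M.toReal_normSq hx, M.toReal_normSq hxb, hA, hB, sub_self,
    norm_zero] at h1
  -- The smoothing is removed on both sides: G_ε is bounded below by G_0 at the solution and above
  -- by G_0 + ε^p |Ω| at wbar.
  have h2 := mul_le_mul_of_nonneg_left (G_zero_le hp hε x.fst) hγ.le
  have h3 := mul_le_mul_of_nonneg_left (G_le hp hε xb.fst) hγ.le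
  linarith

theorem tendsto_rpow_zero_of_tendsto {ε : ℕ → ℝ} (hp : 0 < p) (hε : Tendsto ε atTop (𝓝 0)) :
    Tendsto (fun k => ε k ^ p) atTop (𝓝 0) := by
  have := (Real.continuousAt_rpow_const 0 p (Or.inr hp.le)).tendsto.comp hε
  simpa [Real.zero_rpow hp.ne', Function.comp_def] using this

/-- The penalties tend to zero and the solutions stay bounded. -/
theorem aux_bounds (M : SobolevModel κ s Ω H) (hα : 0 < α) (hβ : 0 < β)
    (hγ : 0 < γ) (hp : p ∈ Ioo (0 : ℝ) 1) (hρ : 0 < ρ)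
    (hf_bdd : ∃ (g : U T Ω →L[ℝ] ℝ) (c : ℝ), ∀ u : U T Ω, g u + c ≤ f u)
    {xb : WithLp 2 (L2 Ω × H)} (hxb : xb ∈ M.graph)
    (hK : ∀ᵐ z ∂(cylMeasure T Ω), |ubar z| ≤ xb.fst z.2)
    {ε : ℕ → ℝ} (hε_pos : ∀ k, 0 < ε k) (hε : Tendsto ε atTop (𝓝 0))
    {u : ℕ → U T Ω} {x : ℕ → WithLp 2 (L2 Ω × H)} (hx : ∀ k, x k ∈ M.graph)
    (hsol : ∀ k, IsAuxSolution κ s T Ω f α β γ p ρ ubar xb.fst (ε k) (u k) (x k).fst) :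
    ∃ C : ℝ, ∀ k, ‖u k‖ ≤ C ∧ ‖x k‖ ≤ C ∧
      ∫ z, (min ((x k).fst z.2 - u k z) 0) ^ 2 ∂(cylMeasure T Ω) ≤ C * ε k ∧
      ∫ z, (min ((x k).fst z.2 + u k z) 0) ^ 2 ∂(cylMeasure T Ω) ≤ C * ε k := by
  obtain ⟨g, c, hg⟩ := hf_bdd
  obtain ⟨B, hB⟩ := (tendsto_rpow_zero_of_tendsto hp.1 hε).bddAbove_range
  have hB' : ∀ k, ε k ^ p ≤ B := fun k => hB ⟨k, rfl⟩
  set m := (volume.restrict Ω).real univ with hm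
  have hm0 : 0 ≤ m := measureReal_nonneg
  -- C₁ bounds -f(u_k), through the affine minorant on the ball of radius ρ around ubar; C₂ bounds
  -- the right-hand side of the comparison.
  set C₁ := ‖g‖ * (‖ubar‖ + ρ) - c with hC₁
  set C₂ := f ubar + α / 2 * ‖ubar‖ ^ 2 + β / 2 * M.quad xb + γ * (G Ω p 0 xb.fst + B * m)
    with hC₂
  have hu : ∀ k, ‖u k - ubar‖ ≤ ρ := fun k => (hsol k).1.2.1
  have hu' : ∀ k, ‖u k‖ ≤ ‖ubar‖ + ρ := fun k => by
    calc ‖u k‖ = ‖ubar + (u k - ubar)‖ := by congr 1; abel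
      _ ≤ _ := (norm_add_le _ _).trans (by linarith [hu k])
  have hmain : ∀ k, 1 / 2 * ‖(x k).fst - xb.fst‖ ^ 2
      + 1 / (2 * ε k) * ∫ z, (min ((x k).fst z.2 - u k z) 0) ^ 2 ∂(cylMeasure T Ω)
      + 1 / (2 * ε k) * ∫ z, (min ((x k).fst z.2 + u k z) 0) ^ 2 ∂(cylMeasure T Ω)
      ≤ C₁ + C₂ := fun k => by
    have h1 := (hsol k).comparison M (hε_pos k) hγ hp hρ hxb hK (hx k)
    have h2 : -(‖g‖ * (‖ubar‖ + ρ)) ≤ g (u k) := by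
      have h3 := (abs_le.1 (Real.norm_eq_abs _ ▸ g.le_opNorm (u k))).1
      have h4 := mul_le_mul_of_nonneg_left (hu' k) (norm_nonneg g)
      linarith
    have h5 := hg (u k)
    have h6 := mul_nonneg (half_pos hβ).le (M.quad_nonneg (x k))
    have h7 := mul_nonneg (half_pos hα).le (sq_nonneg ‖u k‖)
    have h8 := mul_nonneg hγ.le (G_zero_nonneg (p := p) (x k).fst)
    have h9 := mul_le_mul_of_nonneg_left (mul_le_mul_of_nonneg_right (hB' k) hm0) hγ.le
    have h10 := sq_nonneg ‖u k - ubar‖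
    linarith
  have hA0 : ∀ k, 0 ≤ ∫ z, (min ((x k).fst z.2 - u k z) 0) ^ 2 ∂(cylMeasure T Ω) := fun k =>
    integral_nonneg fun z => sq_nonneg _
  have hB0 : ∀ k, 0 ≤ ∫ z, (min ((x k).fst z.2 + u k z) 0) ^ 2 ∂(cylMeasure T Ω) := fun k =>
    integral_nonneg fun z => sq_nonneg _
  have hinv : ∀ k, 0 < 1 / (2 * ε k) := fun k => by have := hε_pos k; positivity
  -- The L² part is bounded by the tracking term, because for θ = 0 the W-ball bounds only the
  -- second component directly.
  have hw : ∀ k, ‖(x k).fst - xb.fst‖ ^ 2 ≤ 2 * (C₁ + C₂) := fun k => by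
    have h1 := mul_nonneg (hinv k).le (hA0 k)
    have h2 := mul_nonneg (hinv k).le (hB0 k)
    linarith [hmain k]
  have hxbd : ∀ k, ‖x k‖ ≤ ‖xb‖ + √(2 * (C₁ + C₂) + ρ ^ 2) := fun k => by
    have hd : x k - xb ∈ M.graph := sub_mem (hx k) hxb
    have h1 : M.quad (x k - xb) ≤ ρ ^ 2 := (M.wNorm_le_iff hd hρ.le).1 (hsol k).1.2.2
    have h2 : ‖(x k - xb).snd‖ ^ 2 ≤ ρ ^ 2 := le_trans
      (le_add_of_nonneg_left (mul_nonneg M.θ_nonneg (sq_nonneg _))) h1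
    have h3 : ‖x k - xb‖ ≤ √(2 * (C₁ + C₂) + ρ ^ 2) := by
      refine Real.le_sqrt_of_sq_le ?_
      rw [WithLp.prod_norm_sq_eq_of_L2, WithLp.sub_fst]
      linarith [hw k]
    calc ‖x k‖ = ‖xb + (x k - xb)‖ := by congr 1; abel
      _ ≤ _ := (norm_add_le _ _).trans (by linarith)
  have hpen : ∀ k (t : ℝ), 1 / (2 * ε k) * t ≤ C₁ + C₂ → t ≤ 2 * (C₁ + C₂) * ε k := fun k t h => by
    have := hε_pos k
    rw [one_div, inv_mul_le_iff₀ (by positivity)] at h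
    linarith
  refine ⟨max (‖ubar‖ + ρ) (max (‖xb‖ + √(2 * (C₁ + C₂) + ρ ^ 2)) (2 * (C₁ + C₂))), fun k =>
    ⟨(hu' k).trans (le_max_left _ _),
      (hxbd k).trans ((le_max_left _ _).trans (le_max_right _ _)), ?_, ?_⟩⟩
  · refine (hpen k _ ?_).trans (mul_le_mul_of_nonneg_right
      ((le_max_right _ _).trans (le_max_right _ _)) (hε_pos k).le)
    have h2 := mul_nonneg (hinv k).le (hB0 k)
    linarith [hmain k, sq_nonneg ‖(x k).fst - xb.fst‖]
  · refine (hpen k _ ?_).trans (mul_le_mul_of_nonneg_right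
      ((le_max_right _ _).trans (le_max_right _ _)) (hε_pos k).le)
    have h2 := mul_nonneg (hinv k).le (hA0 k)
    linarith [hmain k, sq_nonneg ‖(x k).fst - xb.fst‖]

end Convergence

/-- For instance search: this makes L² over a separable measure second countable, as the extraction
of weakly convergent subsequences requires. -/
instance fact_two_ne_top : Fact ((2 : ℝ≥0∞) ≠ ⊤) := ⟨ENNReal.ofNat_ne_top⟩

section Convergence

variable {d : ℕ} {κ : SpaceKind} {s T : ℝ} {Ω : Set (E d)} {H : Type} [NormedAddCommGroup H]
  [InnerProductSpace ℝ H] {f : U T Ω → ℝ} {α β γ p ρ : ℝ} {ubar : U T Ω}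
  [IsFiniteMeasure (volume.restrict Ω)]

/-- The sparsity functional is lower semicontinuous along weakly convergent sequences in `W`. -/
theorem SobolevModel.eventually_G_ge (M : SobolevModel κ s Ω H) (hΩ : IsOpen Ω)
    (hp : p ∈ Ioo (0 : ℝ) 1) {x : ℕ → WithLp 2 (L2 Ω × H)} {a : WithLp 2 (L2 Ω × H)}
    (hx : ∀ k, x k ∈ M.graph) (ha : a ∈ M.graph) {C : ℝ} (hC : ∀ k, ‖x k‖ ≤ C)
    (hxa : WeakConv x a) {δ : ℝ} (hδ : 0 < δ) :
    ∀ᶠ n in atTop, G Ω p 0 a.fst - δ ≤ G Ω p 0 (x n).fst := by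
  simp only [G_zero]
  refine eventually_integral_abs_rpow_ge hp
    (S := fun m : ℕ => innerSet Ω (1 / ((m : ℝ) + 1)))
    (fun m => (isClosed_innerSet Ω _).measurableSet) (monotone_innerSet Ω) ?_
    (w := fun n => (x n).fst) (fun m => ?_) hδ
  · filter_upwards [ae_restrict_mem hΩ.measurableSet] with z hz using iUnion_innerSet hΩ hz
  · have h := M.compact (fun n => x n - a) (C + ‖a‖) (fun n => sub_mem (hx n) ha)
      (fun n => (norm_sub_le _ _).trans (by linarith [hC n])) (by simpa using hxa.sub_const a)
      (1 / ((m : ℝ) + 1)) (by positivity)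
    simpa only [WithLp.sub_fst] using h

variable [CompleteSpace H]

/-- The weak limit competes with (ubar, wbar) in the local problem, while (ubar, wbar) competes with
(u_k, w_k) in the auxiliary one. Chaining the two inequalities leaves only the defects `D` and the
tracking terms `e` of the limit. -/
theorem tendsto_of_weakConv (M : SobolevModel κ s Ω H) (hΩ : IsOpen Ω)
    (hα : 0 < α) (hβ : 0 < β) (hγ : 0 < γ) (hp : p ∈ Ioo (0 : ℝ) 1) (hρ : 0 < ρ)
    (hf_lsc : WeaklyLSC f) {xb : WithLp 2 (L2 Ω × H)} (hxb : xb ∈ M.graph)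
    (hloc : IsLocalSolution κ s T Ω f α β γ p ρ ubar xb.fst)
    {ε : ℕ → ℝ} (hε_pos : ∀ k, 0 < ε k) (hε : Tendsto ε atTop (𝓝 0))
    {u : ℕ → U T Ω} {x : ℕ → WithLp 2 (L2 Ω × H)} (hx : ∀ k, x k ∈ M.graph)
    (hsol : ∀ k, IsAuxSolution κ s T Ω f α β γ p ρ ubar xb.fst (ε k) (u k) (x k).fst)
    {C : ℝ} (hC : ∀ k, ‖u k‖ ≤ C ∧ ‖x k‖ ≤ C ∧
      ∫ z, (min ((x k).fst z.2 - u k z) 0) ^ 2 ∂(cylMeasure T Ω) ≤ C * ε k ∧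
      ∫ z, (min ((x k).fst z.2 + u k z) 0) ^ 2 ∂(cylMeasure T Ω) ≤ C * ε k)
    {us : U T Ω} {xs : WithLp 2 (L2 Ω × H)} (hus : WeakConv u us) (hxs : WeakConv x xs) :
    Tendsto u atTop (𝓝 ubar) ∧
      Tendsto (fun k => wNorm κ s Ω ((x k).fst - xb.fst)) atTop (𝓝 0) := by
  have hws : WeakConv (fun k => (x k).fst) xs.fst := hxs.map (WithLp.fstL 2 ℝ (L2 Ω) H)
  have hxsM : xs ∈ M.graph := hxs.mem_of_isClosed M.isClosed hx
  have hCε : Tendsto (fun k => C * ε k) atTop (𝓝 0) := by simpa using hε.const_mul C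
  have hKs : (us, xs.fst) ∈ K κ s T Ω := ⟨(M.mem_W _).2 ⟨xs, hxsM, rfl⟩,
    abs_le_of_weakConv hus hws
      (squeeze_zero (fun k => integral_nonneg fun z => sq_nonneg _) (fun k => (hC k).2.2.1) hCε)
      (squeeze_zero (fun k => integral_nonneg fun z => sq_nonneg _) (fun k => (hC k).2.2.2) hCε)⟩
  have husρ : ‖us - ubar‖ ≤ ρ := by
    refine le_of_sq_le_sq ((hus.sub_const ubar).norm_sq_le fun n => ?_) hρ.le
    exact pow_le_pow_left₀ (norm_nonneg _) (hsol n).1.2.1 2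
  have hxsρ : M.quad (xs - xb) ≤ ρ ^ 2 := by
    refine le_of_tendsto (M.tendsto_quad_sub (hxs.sub_const xb)) (Eventually.of_forall fun n => ?_)
    have h1 : M.quad (x n - xb) ≤ ρ ^ 2 :=
      (M.wNorm_le_iff (sub_mem (hx n) hxb) hρ.le).1 (hsol n).1.2.2
    linarith [M.quad_nonneg (x n - xb - (xs - xb))]
  have hmin := hloc.2 us xs.fst hKs husρ ((M.wNorm_le_iff (sub_mem hxsM hxb) hρ.le).2 hxsρ)
  simp only [Phi, M.toReal_normSq hxb, M.toReal_normSq hxsM] at hmin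
  set m := (volume.restrict Ω).real univ with hm
  set D : ℕ → ℝ := fun n => α / 2 * ‖u n - us‖ ^ 2 + β / 2 * M.quad (x n - xs) with hD
  have hD0 : ∀ n, 0 ≤ D n := fun n => add_nonneg
    (mul_nonneg (half_pos hα).le (sq_nonneg _))
    (mul_nonneg (half_pos hβ).le (M.quad_nonneg _))
  set e := 1 / 2 * ‖us - ubar‖ ^ 2 + 1 / 2 * ‖xs.fst - xb.fst‖ ^ 2 with he
  have he0 : 0 ≤ e := by positivity
  -- Every quadratic term is paired with its defect, so that the sum converges. The defects of the α
  -- and β terms become `D`; those of the tracking terms are nonnegative and are dropped.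
  have hS : Tendsto (fun n => α / 2 * (‖u n‖ ^ 2 - ‖u n - us‖ ^ 2)
      + β / 2 * (M.quad (x n) - M.quad (x n - xs))
      + (1 / 2 * (‖u n - ubar‖ ^ 2 - ‖u n - ubar - (us - ubar)‖ ^ 2)
        + 1 / 2 * (‖(x n).fst - xb.fst‖ ^ 2 - ‖(x n).fst - xb.fst - (xs.fst - xb.fst)‖ ^ 2))
      - γ * (ε n ^ p * m)) atTop
      (𝓝 (α / 2 * ‖us‖ ^ 2 + β / 2 * M.quad xs + e - γ * (0 * m))) :=
    (((hus.norm_sq_sub.const_mul _).add ((M.tendsto_quad_sub hxs).const_mul _)).add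
      (((hus.sub_const ubar).norm_sq_sub.const_mul _).add
        ((hws.sub_const xb.fst).norm_sq_sub.const_mul _))).sub
      (((tendsto_rpow_zero_of_tendsto hp.1 hε).mul_const m).const_mul γ)
  -- One δ each is spent on f, on γ G_0 and on the quadratic terms.
  have hsmall : ∀ δ : ℝ, 0 < δ → ∀ᶠ n in atTop, D n + e ≤ 3 * δ := by
    intro δ hδ
    have hfl : ∀ᶠ n in atTop, ((f us - δ : ℝ) : EReal) < (f (u n) : EReal) := by
      refine eventually_lt_of_lt_liminf (lt_of_lt_of_le ?_ (hf_lsc u us hus))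
      exact_mod_cast sub_lt_self _ hδ
    filter_upwards [hfl, M.eventually_G_ge hΩ hp hx hxsM (fun k => (hC k).2.1) hxs
      (div_pos hδ hγ), hS.eventually (lt_mem_nhds (sub_lt_self _ hδ))] with n h1 h2 h3
    have h1' : f us - δ < f (u n) := by exact_mod_cast h1
    have h2' : γ * G Ω p 0 xs.fst - δ ≤ γ * G Ω p 0 (x n).fst := by
      have := mul_le_mul_of_nonneg_left h2 hγ.le
      rwa [mul_sub, mul_div_cancel₀ _ hγ.ne'] at this
    have hkey := (hsol n).comparison M (hε_pos n) hγ hp hρ hxb hloc.1.2 (hx n)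
    have hinv : 0 < 1 / (2 * ε n) := by have := hε_pos n; positivity
    have hA := mul_nonneg hinv.le (integral_nonneg (μ := cylMeasure T Ω)
      fun z => sq_nonneg (min ((x n).fst z.2 - u n z) 0))
    have hB := mul_nonneg hinv.le (integral_nonneg (μ := cylMeasure T Ω)
      fun z => sq_nonneg (min ((x n).fst z.2 + u n z) 0))
    have h4 := sq_nonneg ‖u n - ubar - (us - ubar)‖
    have h5 := sq_nonneg ‖(x n).fst - xb.fst - (xs.fst - xb.fst)‖
    simp only [hD]
    linarith
  have he' : e = 0 := by
    refine le_antisymm (le_of_forall_pos_le_add fun δ hδ => ?_) he0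
    obtain ⟨n, hn⟩ := (hsmall (δ / 3) (by linarith)).exists
    linarith [hD0 n]
  have hDlim : Tendsto D atTop (𝓝 0) := by
    refine tendsto_order.2 ⟨fun a ha => Eventually.of_forall fun n => ha.trans_le (hD0 n),
      fun a ha => ?_⟩
    filter_upwards [hsmall (a / 4) (by linarith)] with n hn
    linarith
  have hus_eq : us = ubar := by
    rw [← sub_eq_zero, ← norm_eq_zero]
    nlinarith [norm_nonneg (us - ubar), sq_nonneg ‖xs.fst - xb.fst‖]
  have hxs_eq : xs.fst = xb.fst := by
    rw [← sub_eq_zero, ← norm_eq_zero]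
    nlinarith [norm_nonneg (xs.fst - xb.fst), sq_nonneg ‖us - ubar‖]
  constructor
  · rw [tendsto_iff_norm_sub_tendsto_zero]
    have h1 : Tendsto (fun n => √(2 / α * D n)) atTop (𝓝 0) := by
      simpa using (hDlim.const_mul (2 / α)).sqrt
    refine squeeze_zero (fun n => norm_nonneg _) (fun n => Real.le_sqrt_of_sq_le ?_) h1
    rw [← hus_eq, div_mul_eq_mul_div, le_div_iff₀ hα]
    have := mul_nonneg (half_pos hβ).le (M.quad_nonneg (x n - xs))
    simp only [hD]
    linarith
  · have h1 : Tendsto (fun n => ENNReal.ofReal √(2 / β * D n)) atTop (𝓝 0) := by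
      have := ENNReal.tendsto_ofReal (hDlim.const_mul (2 / β)).sqrt
      simpa using this
    refine tendsto_of_tendsto_of_tendsto_of_le_of_le tendsto_const_nhds h1 (fun n => zero_le)
      fun n => ?_
    change wNorm κ s Ω ((x n).fst - xb.fst) ≤ _
    -- Only the first components of `xs` and `xb` have been identified; this is enough, as the
    -- W-norm is a function of the first component.
    rw [← hxs_eq, ← WithLp.sub_fst, M.wNorm_eq (sub_mem (hx n) hxsM)]
    refine ENNReal.ofReal_le_ofReal (Real.sqrt_le_sqrt ?_)
    rw [div_mul_eq_mul_div, le_div_iff₀ hβ]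
    have := mul_nonneg (half_pos hα).le (sq_nonneg ‖u n - us‖)
    simp only [hD]
    linarith

/-- Convergence of the solutions of the auxiliary problems, for a space `W` with a model. -/
theorem SobolevModel.tendsto_solutions [SecondCountableTopology H] (M : SobolevModel κ s Ω H)
    (hΩ : IsOpen Ω)
    (hα : 0 < α) (hβ : 0 < β) (hγ : 0 < γ) (hp : p ∈ Ioo (0 : ℝ) 1) (hρ : 0 < ρ)
    (hf_lsc : WeaklyLSC f)
    (hf_bdd : ∃ (g : U T Ω →L[ℝ] ℝ) (c : ℝ), ∀ u : U T Ω, g u + c ≤ f u)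
    {wbar : L2 Ω} (hloc : IsLocalSolution κ s T Ω f α β γ p ρ ubar wbar)
    {ε : ℕ → ℝ} (hε_pos : ∀ k, 0 < ε k) (hε : Tendsto ε atTop (𝓝 0))
    {u : ℕ → U T Ω} {w : ℕ → L2 Ω}
    (hsol : ∀ k, IsAuxSolution κ s T Ω f α β γ p ρ ubar wbar (ε k) (u k) (w k)) :
    Tendsto u atTop (𝓝 ubar) ∧
      Tendsto (fun k => wNorm κ s Ω (w k - wbar)) atTop (𝓝 0) := by
  obtain ⟨xb, hxb, rfl⟩ := (M.mem_W _).1 hloc.1.1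
  choose x hx hxw using fun k => (M.mem_W _).1 (hsol k).1.1
  obtain rfl : (fun k => (x k).fst) = w := funext hxw
  obtain ⟨C, hC⟩ := aux_bounds M hα hβ hγ hp hρ hf_bdd hxb hloc.1.2 hε_pos hε hx hsol
  -- Subsequence principle: every subsequence has a further one with the required limits, obtained
  -- by extracting weak limits first for u and then for x.
  have key : ∀ ns : ℕ → ℕ, Tendsto ns atTop atTop → ∃ ms : ℕ → ℕ,
      Tendsto (fun n => u (ns (ms n))) atTop (𝓝 ubar) ∧
      Tendsto (fun n => wNorm κ s Ω ((x (ns (ms n))).fst - xb.fst)) atTop (𝓝 0) := by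
    intro ns hns
    obtain ⟨us, φ, hφ, hus⟩ := exists_weakConv_subseq (x := u ∘ ns) fun n => (hC (ns n)).1
    obtain ⟨xs, χ, hχ, hxs⟩ := exists_weakConv_subseq (x := x ∘ ns ∘ φ)
      fun n => (hC (ns (φ n))).2.1
    refine ⟨φ ∘ χ, tendsto_of_weakConv M hΩ hα hβ hγ hp hρ hf_lsc hxb hloc
      (ε := fun n => ε (ns (φ (χ n)))) (fun k => hε_pos _)
      (hε.comp (hns.comp (hφ.tendsto_atTop.comp hχ.tendsto_atTop))) (u := fun n => u (ns (φ (χ n))))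
      (x := fun n => x (ns (φ (χ n)))) (fun k => hx _) (fun k => hsol _) (fun k => hC _)
      (hus.comp hχ) hxs⟩
  exact ⟨tendsto_of_subseq_tendsto fun ns hns => (key ns hns).imp fun _ h => h.1,
    tendsto_of_subseq_tendsto fun ns hns => (key ns hns).imp fun _ h => h.2⟩

end Convergence

/-! ### Averages over balls -/

section Averages

variable {d : ℕ} {Ω : Set (E d)}

/-- The average over the ball of radius `r` around `x` of the extension by zero of `w`. -/
def ballAvg (Ω : Set (E d)) (r : ℝ) (w : L2 Ω) (x : E d) : ℝ :=
  (volume.real (Metric.ball (0 : E d) r))⁻¹ * ∫ y in Metric.ball x r, w y ∂(volume.restrict Ω)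

theorem ballAvg_eq_indicator (hΩ : MeasurableSet Ω) (r : ℝ) (w : L2 Ω) (x : E d) :
    ballAvg Ω r w x =
      (volume.real (Metric.ball (0 : E d) r))⁻¹ * ∫ y in Metric.ball x r, Ω.indicator w y := by
  rw [ballAvg, Measure.restrict_restrict measurableSet_ball, setIntegral_indicator hΩ]

theorem measurable_ballAvg [SFinite (volume.restrict Ω)] (r : ℝ) (w : L2 Ω) :
    Measurable (ballAvg Ω r w) := by
  have h : StronglyMeasurable (fun q : E d × E d =>
      {q : E d × E d | dist q.2 q.1 < r}.indicator (fun q => w q.2) q) :=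
    ((Lp.stronglyMeasurable w).comp_measurable measurable_snd).indicator
      (measurableSet_lt (measurable_snd.dist measurable_fst) measurable_const)
  have h2 := h.integral_prod_right' (ν := volume.restrict Ω)
  refine Measurable.const_mul ?_ _
  convert h2.measurable using 2 with x
  rw [← integral_indicator measurableSet_ball]
  rfl

/-- In this form weak convergence of w gives convergence of its averages at every point. -/
theorem integral_ball_eq_inner [IsFiniteMeasure (volume.restrict Ω)] (r : ℝ) (w : L2 Ω)
    (x : E d) : ∫ y in Metric.ball x r, w y ∂(volume.restrict Ω) =
      ⟪indicatorConstLp 2 (measurableSet_ball (x := x) (ε := r))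
        (measure_ne_top (volume.restrict Ω) _) (1 : ℝ), w⟫_ℝ :=
  (L2.inner_indicatorConstLp_one _ _ w).symm

theorem abs_ballAvg_le [IsFiniteMeasure (volume.restrict Ω)] (r : ℝ) (w : L2 Ω) (x : E d) :
    |ballAvg Ω r w x| ≤ (volume.real (Metric.ball (0 : E d) r))⁻¹ *
      ((volume.restrict Ω).real univ ^ (1 / 2 : ℝ) * ‖w‖) := by
  rw [ballAvg, integral_ball_eq_inner, abs_mul, abs_of_nonneg (inv_nonneg.2 measureReal_nonneg)]
  refine mul_le_mul_of_nonneg_left ((abs_real_inner_le_norm _ _).trans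
    (mul_le_mul_of_nonneg_right ?_ (norm_nonneg _))) (inv_nonneg.2 measureReal_nonneg)
  rw [norm_indicatorConstLp (by norm_num) (by norm_num)]
  simp only [norm_one, one_mul, ENNReal.toReal_ofNat]
  exact Real.rpow_le_rpow measureReal_nonneg (measureReal_mono (subset_univ _)) (by norm_num)

/-- Averaging turns bounded weakly convergent sequences into strongly convergent ones. -/
theorem tendsto_lintegral_ballAvg [IsFiniteMeasure (volume.restrict Ω)] (r : ℝ) {w : ℕ → L2 Ω}
    {C : ℝ} (hC : ∀ n, ‖w n‖ ≤ C) (hw : WeakConv w 0) :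
    Tendsto (fun n => ∫⁻ x in Ω, ENNReal.ofReal (ballAvg Ω r (w n) x ^ 2)) atTop (𝓝 0) := by
  set B := (volume.real (Metric.ball (0 : E d) r))⁻¹ *
    ((volume.restrict Ω).real univ ^ (1 / 2 : ℝ) * C)
  -- The averages tend to zero pointwise by weak convergence, and Cauchy–Schwarz bounds them by a
  -- constant, integrable as Ω has finite measure.
  have h := tendsto_lintegral_of_dominated_convergence (μ := volume.restrict Ω)
    (F := fun n x => ENNReal.ofReal (ballAvg Ω r (w n) x ^ 2)) (f := fun _ => 0)
    (fun _ => ENNReal.ofReal (B ^ 2))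
    (fun n => ((measurable_ballAvg r (w n)).pow_const 2).ennreal_ofReal)
    (fun n => Eventually.of_forall fun x => ENNReal.ofReal_le_ofReal ?_) ?_
    (Eventually.of_forall fun x => ?_)
  · simpa using h
  · refine sq_le_sq' ?_ ?_ <;>
    have := (abs_le.1 ((abs_ballAvg_le r (w n) x).trans (mul_le_mul_of_nonneg_left
      (mul_le_mul_of_nonneg_left (hC n) (Real.rpow_nonneg measureReal_nonneg _))
      (inv_nonneg.2 measureReal_nonneg))))
    exacts [this.1, this.2]
  · rw [lintegral_const]
    exact ENNReal.mul_ne_top ENNReal.ofReal_ne_top (measure_ne_top _ _)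
  · have h1 : Tendsto (fun n => ballAvg Ω r (w n) x) atTop (𝓝 0) := by
      simp only [ballAvg, integral_ball_eq_inner]
      have := (hw (indicatorConstLp 2 (measurableSet_ball (x := x) (ε := r))
        (measure_ne_top (volume.restrict Ω) _) (1 : ℝ))).const_mul
          (volume.real (Metric.ball (0 : E d) r))⁻¹
      simpa only [real_inner_comm, inner_zero_left, mul_zero, inner_zero_right] using this
    have := ENNReal.tendsto_ofReal (h1.pow 2)
    simpa using this

/-- A bounded weakly convergent sequence that is uniformly close to its averages converges
strongly. -/
theorem tendsto_integral_sq_of_ballAvg [IsFiniteMeasure (volume.restrict Ω)] {S : Set (E d)}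
    {w : ℕ → L2 Ω} {C : ℝ} (hC : ∀ n, ‖w n‖ ≤ C) (hw : WeakConv w 0)
    (h : ∀ η : ℝ, 0 < η → ∃ r : ℝ, ∀ n, ∫⁻ x in S,
      ENNReal.ofReal ((w n x - ballAvg Ω r (w n) x) ^ 2) ∂(volume.restrict Ω)
        ≤ ENNReal.ofReal η) :
    Tendsto (fun n => ∫ x in S, (w n x) ^ 2 ∂(volume.restrict Ω)) atTop (𝓝 0) := by
  have key : Tendsto (fun n => ∫⁻ x in S, ENNReal.ofReal ((w n x) ^ 2) ∂(volume.restrict Ω))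
      atTop (𝓝 0) := by
    rw [ENNReal.tendsto_nhds_zero]
    intro η hη
    rcases eq_or_ne η ⊤ with rfl | hη'
    · simp
    obtain ⟨η, rfl⟩ : ∃ t : ℝ, η = ENNReal.ofReal t := ⟨η.toReal, (ENNReal.ofReal_toReal hη').symm⟩
    rw [gt_iff_lt, ENNReal.ofReal_pos] at hη
    obtain ⟨r, hr⟩ := h (η / 4) (by linarith)
    have h1 := (ENNReal.tendsto_nhds_zero.1 (tendsto_lintegral_ballAvg r hC hw))
      (ENNReal.ofReal (η / 4)) (by rw [gt_iff_lt, ENNReal.ofReal_pos]; linarith)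
    filter_upwards [h1] with n hn
    -- With A the average, w² ≤ 2 (w - A)² + 2 A², the gap being (w - 2A)². Each integral is at most
    -- η/4.
    calc ∫⁻ x in S, ENNReal.ofReal ((w n x) ^ 2) ∂(volume.restrict Ω)
        ≤ ∫⁻ x in S, (ENNReal.ofReal 2 * ENNReal.ofReal ((w n x - ballAvg Ω r (w n) x) ^ 2)
          + ENNReal.ofReal 2 * ENNReal.ofReal (ballAvg Ω r (w n) x ^ 2)) ∂(volume.restrict Ω) := by
          refine lintegral_mono fun x => ?_
          rw [← ENNReal.ofReal_mul (by norm_num), ← ENNReal.ofReal_mul (by norm_num),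
            ← ENNReal.ofReal_add (by positivity) (by positivity)]
          refine ENNReal.ofReal_le_ofReal ?_
          nlinarith [sq_nonneg (w n x - 2 * ballAvg Ω r (w n) x)]
      _ ≤ ENNReal.ofReal 2 * ENNReal.ofReal (η / 4) +
          ENNReal.ofReal 2 * ENNReal.ofReal (η / 4) := by
          have hm : Measurable fun x => ENNReal.ofReal (ballAvg Ω r (w n) x ^ 2) :=
            ((measurable_ballAvg r (w n)).pow_const 2).ennreal_ofReal
          rw [lintegral_add_right _ (hm.const_mul _),
            lintegral_const_mul' _ _ ENNReal.ofReal_ne_top,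
            lintegral_const_mul' _ _ ENNReal.ofReal_ne_top]
          gcongr
          · exact hr n
          · exact (lintegral_mono' Measure.restrict_le_self le_rfl).trans hn
      _ = ENNReal.ofReal η := by
          rw [← ENNReal.ofReal_mul (by norm_num),
            ← ENNReal.ofReal_add (by positivity) (by positivity)]
          congr 1; ring
  have := (ENNReal.tendsto_toReal ENNReal.zero_ne_top).comp key
  rw [ENNReal.toReal_zero] at this
  refine this.congr fun n => ?_
  rw [Function.comp, integral_eq_lintegral_of_nonneg_ae
    (Eventually.of_forall fun x => sq_nonneg _) (integrable_sq (w n)).integrableOn.1]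

/-- Jensen's inequality for the deviation from an average. -/
theorem sq_sub_average_le {v : E d → ℝ} (hv : MemLp v 2) (x : E d) {r : ℝ} (hr : 0 < r) :
    ENNReal.ofReal ((v x - (volume.real (Metric.ball (0 : E d) r))⁻¹ *
        ∫ y in Metric.ball x r, v y) ^ 2) ≤
      ENNReal.ofReal (volume.real (Metric.ball (0 : E d) r))⁻¹ *
        ∫⁻ y in Metric.ball x r, ENNReal.ofReal ((v x - v y) ^ 2) := by
  have hBx : volume.real (Metric.ball x r) = volume.real (Metric.ball (0 : E d) r) := by
    simp only [Measure.real, Measure.addHaar_ball_center]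
  set B := volume.real (Metric.ball (0 : E d) r) with hB
  have hBpos : 0 < B :=
    ENNReal.toReal_pos (Metric.measure_ball_pos _ _ hr).ne' measure_ball_lt_top.ne
  have : IsFiniteMeasure (volume.restrict (Metric.ball x r)) :=
    ⟨by simpa using measure_ball_lt_top⟩
  have hvr : MemLp v 2 (volume.restrict (Metric.ball x r)) := hv.restrict _
  have hvi : Integrable v (volume.restrict (Metric.ball x r)) := hvr.integrable (by norm_num)
  have hgm : MemLp (fun y => v x - v y) 2 (volume.restrict (Metric.ball x r)) :=
    (memLp_const _).sub hvr
  rw [← ofReal_integral_eq_lintegral_ofReal hgm.integrable_sq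
    (Eventually.of_forall fun y => sq_nonneg _), ← ENNReal.ofReal_mul (inv_nonneg.2 hBpos.le)]
  refine ENNReal.ofReal_le_ofReal ?_
  set a := v x - B⁻¹ * ∫ y in Metric.ball x r, v y with ha
  have hI : ∫ y in Metric.ball x r, (v x - v y) = B * a := by
    rw [integral_sub (integrable_const _) hvi, integral_const, smul_eq_mul,
      measureReal_restrict_apply_univ, hBx, ha]
    field_simp
  -- Nonnegativity of the variance: a is the mean of v(x) - v(y) over the ball, so B a² is at most
  -- the integral of (v(x) - v(y))².
  have h0 : 0 ≤ ∫ y in Metric.ball x r, (v x - v y - a) ^ 2 := integral_nonneg fun y => sq_nonneg _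
  have h1 : ∫ y in Metric.ball x r, (v x - v y - a) ^ 2 =
      (∫ y in Metric.ball x r, (v x - v y) ^ 2) - B * a ^ 2 := by
    have e : ∀ y, (v x - v y - a) ^ 2 = (v x - v y) ^ 2 - (2 * a * (v x - v y) - a ^ 2) :=
      fun y => by ring
    have i1 : Integrable (fun y => v x - v y) (volume.restrict (Metric.ball x r)) :=
      (integrable_const _).sub hvi
    have i2 : Integrable (fun y => 2 * a * (v x - v y) - a ^ 2)
      (volume.restrict (Metric.ball x r)) := (i1.const_mul _).sub (integrable_const _)
    simp only [e]
    rw [integral_sub hgm.integrable_sq i2, integral_sub (i1.const_mul _) (integrable_const _),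
      integral_const_mul, hI, integral_const, smul_eq_mul, measureReal_restrict_apply_univ, hBx]
    ring
  rw [h1] at h0
  rw [le_inv_mul_iff₀ hBpos]
  linarith

/-- Deviations from averages are controlled by the Gagliardo seminorm. -/
theorem lintegral_sub_average_le {v : E d → ℝ} (hv : MemLp v 2) {s : ℝ} (hs : 0 ≤ s)
    {S D : Set (E d)} {r : ℝ} (hr : 0 < r) (hSD : ∀ x ∈ S, Metric.ball x r ⊆ D)
    (hS : MeasurableSet S) :
    ∫⁻ x in S, ENNReal.ofReal ((v x - (volume.real (Metric.ball (0 : E d) r))⁻¹ *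
        ∫ y in Metric.ball x r, v y) ^ 2) ≤
      ENNReal.ofReal ((volume.real (Metric.ball (0 : E d) r))⁻¹ * r ^ ((d : ℝ) + 2 * s)) *
        ∫⁻ x in D, ∫⁻ y in D,
          ENNReal.ofReal ((v x - v y) ^ 2 / ‖x - y‖ ^ ((d : ℝ) + 2 * s)) := by
  have hexp : 0 ≤ (d : ℝ) + 2 * s := by positivity
  have hSD' : S ⊆ D := fun x hx => hSD x hx (Metric.mem_ball_self hr)
  refine le_trans ?_ (mul_le_mul_right (lintegral_mono_set hSD') _)
  rw [← lintegral_const_mul' _ _ ENNReal.ofReal_ne_top]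
  refine setLIntegral_mono' hS fun x hx => (sq_sub_average_le hv x hr).trans ?_
  rw [ENNReal.ofReal_mul (inv_nonneg.2 measureReal_nonneg), mul_assoc]
  refine mul_le_mul_right ?_ _
  refine le_trans ?_ (mul_le_mul_right (lintegral_mono_set (hSD x hx)) _)
  rw [← lintegral_const_mul' _ _ ENNReal.ofReal_ne_top]
  refine setLIntegral_mono' measurableSet_ball fun y hy => ?_
  rw [← ENNReal.ofReal_mul (Real.rpow_nonneg hr.le _)]
  refine ENNReal.ofReal_le_ofReal ?_
  -- Off the diagonal, r^{d+2s} / ‖x - y‖^{d+2s} ≥ 1 inside the ball; on it the left side is zero.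
  rcases eq_or_ne x y with rfl | hxy
  · simp
  have hpos : 0 < ‖x - y‖ ^ ((d : ℝ) + 2 * s) :=
    Real.rpow_pos_of_pos (norm_pos_iff.2 (sub_ne_zero.2 hxy)) _
  have hle : ‖x - y‖ ^ ((d : ℝ) + 2 * s) ≤ r ^ ((d : ℝ) + 2 * s) :=
    Real.rpow_le_rpow (norm_nonneg _) (by
      rw [← dist_eq_norm, dist_comm]; exact (Metric.mem_ball.1 hy).le) hexp
  rw [mul_div_assoc', le_div_iff₀ hpos, mul_comm]
  exact mul_le_mul_of_nonneg_right hle (sq_nonneg _)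

/-- The volume scales like r^d, so the factor is r^{2s} divided by the volume of the unit ball. -/
theorem tendsto_ball_inv_mul_rpow {s : ℝ} (hs : 0 < s) :
    Tendsto (fun r : ℝ => (volume.real (Metric.ball (0 : E d) r))⁻¹ * r ^ ((d : ℝ) + 2 * s))
      (𝓝[>] 0) (𝓝 0) := by
  set B := volume.real (Metric.ball (0 : E d) 1) with hB
  have hBpos : 0 < B :=
    ENNReal.toReal_pos (Metric.measure_ball_pos _ _ one_pos).ne' measure_ball_lt_top.ne
  have h1 : Tendsto (fun r : ℝ => B⁻¹ * r ^ (2 * s)) (𝓝[>] 0) (𝓝 0) := by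
    have := ((Real.continuousAt_rpow_const 0 (2 * s) (Or.inr (by positivity))).tendsto.const_mul
      B⁻¹).mono_left (nhdsWithin_le_nhds (s := Ioi 0))
    simpa [Real.zero_rpow (by positivity : 2 * s ≠ 0)] using this
  refine h1.congr' ?_
  filter_upwards [self_mem_nhdsWithin] with r hr
  have hr : 0 < r := hr
  have e : volume.real (Metric.ball (0 : E d) r) = r ^ d * B := by
    rw [Measure.real, Measure.addHaar_ball_of_pos volume 0 hr, ENNReal.toReal_mul,
      ENNReal.toReal_ofReal (by positivity), finrank_euclideanSpace_fin, hB, Measure.real]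
  rw [e, Real.rpow_add hr, Real.rpow_natCast]
  field_simp

end Averages

/-! ### Models of the spaces defined by Gagliardo seminorms -/

section Gagliardo

variable {d : ℕ} {s : ℝ} {Ω D : Set (E d)}

theorem fracConst_pos (d : ℕ) (hs : s ∈ Ioo (0 : ℝ) 1) : 0 < fracConst d s := by
  have h1 : 0 < Real.Gamma (s + (d : ℝ) / 2) :=
    Real.Gamma_pos_of_pos (add_pos_of_pos_of_nonneg hs.1 (by positivity))
  have h2 : 0 < Real.Gamma (1 - s) := Real.Gamma_pos_of_pos (sub_pos.2 hs.2)
  have h3 := hs.1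
  unfold fracConst
  positivity

/-- The weighted difference quotient whose squared `L²`-norm is the Gagliardo seminorm. -/
def gagliardo {d : ℕ} (s : ℝ) (v : E d → ℝ) (q : E d × E d) : ℝ :=
  (v q.1 - v q.2) * √(fracConst d s / 2 / ‖q.1 - q.2‖ ^ ((d : ℝ) + 2 * s))

theorem measurable_gagliardo {v : E d → ℝ} (hv : Measurable v) : Measurable (gagliardo s v) := by
  unfold gagliardo
  fun_prop

theorem gagliardo_sq (hs : s ∈ Ioo (0 : ℝ) 1) (v : E d → ℝ) (q : E d × E d) :
    gagliardo s v q ^ 2 = fracConst d s / 2 *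
      ((v q.1 - v q.2) ^ 2 / ‖q.1 - q.2‖ ^ ((d : ℝ) + 2 * s)) := by
  have := fracConst_pos d hs
  rw [gagliardo, mul_pow, Real.sq_sqrt (by positivity)]
  ring

/-- The measure on pairs of points of `D`. -/
abbrev pairMeasure (D : Set (E d)) : Measure (E d × E d) :=
  (volume.restrict D).prod (volume.restrict D)

instance sFinite_pairMeasure (D : Set (E d)) : SFinite (pairMeasure D) := inferInstance

instance isSeparable_pairMeasure (D : Set (E d)) : IsSeparable (pairMeasure D) := inferInstance

theorem lintegral_gagliardo_sq (hs : s ∈ Ioo (0 : ℝ) 1) {v : E d → ℝ} (hv : Measurable v) :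
    ∫⁻ q, ENNReal.ofReal (gagliardo s v q ^ 2) ∂(pairMeasure D) =
      ENNReal.ofReal (fracConst d s / 2) * ∫⁻ x in D, ∫⁻ y in D,
        ENNReal.ofReal ((v x - v y) ^ 2 / ‖x - y‖ ^ ((d : ℝ) + 2 * s)) := by
  rw [lintegral_prod _ ((measurable_gagliardo hv).pow_const 2).ennreal_ofReal.aemeasurable,
    ← lintegral_const_mul' _ _ ENNReal.ofReal_ne_top]
  refine lintegral_congr fun x => ?_
  rw [← lintegral_const_mul' _ _ ENNReal.ofReal_ne_top]
  refine lintegral_congr fun y => ?_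
  rw [gagliardo_sq hs, ENNReal.ofReal_mul (half_pos (fracConst_pos d hs)).le]

theorem hsNormSq_congr_ae {v v' : E d → ℝ} (h : v =ᵐ[volume.restrict D] v') :
    hsNormSq s D v = hsNormSq s D v' := by
  unfold hsNormSq
  congr 1
  · exact lintegral_congr_ae (h.mono fun x hx => by simp only [hx])
  · congr 1
    exact lintegral_congr_ae (h.mono fun x hx => lintegral_congr_ae (h.mono fun y hy => by
      simp only [hx, hy]))

theorem lintegral_indicator_sq (hΩ : MeasurableSet Ω) (hΩD : Ω ⊆ D) (w : L2 Ω) :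
    ∫⁻ x in D, ENNReal.ofReal (Ω.indicator w x ^ 2) = ENNReal.ofReal (‖w‖ ^ 2) := by
  have e : ∀ x, ENNReal.ofReal (Ω.indicator w x ^ 2) =
      Ω.indicator (fun x => ENNReal.ofReal (w x ^ 2)) x := fun x => by
    by_cases hx : x ∈ Ω <;> simp [hx]
  simp only [e]
  rw [lintegral_indicator hΩ, Measure.restrict_restrict hΩ, inter_eq_left.2 hΩD,
    Lp_norm_sq_eq_lintegral]

theorem measurable_indicator_coe (hΩ : MeasurableSet Ω) (w : L2 Ω) :
    Measurable (Ω.indicator w) :=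
  (Lp.stronglyMeasurable w).measurable.indicator hΩ

theorem memLp_indicator_coe (hΩ : MeasurableSet Ω) (w : L2 Ω) : MemLp (Ω.indicator w) 2 volume :=
  (memLp_indicator_iff_restrict hΩ).2 (Lp.memLp w)

theorem ae_pair {P : E d → Prop} (h : ∀ᵐ x, P x) : ∀ᵐ q ∂(pairMeasure D), P q.1 ∧ P q.2 :=
  (Measure.quasiMeasurePreserving_fst.ae (ae_restrict_of_ae h)).and
    (Measure.quasiMeasurePreserving_snd.ae (ae_restrict_of_ae h))

theorem ae_indicator (hΩ : MeasurableSet Ω) {P : E d → Prop}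
    (h : ∀ᵐ x ∂(volume.restrict Ω), P x) : ∀ᵐ x, x ∈ Ω → P x :=
  (ae_restrict_iff' hΩ).1 h

/-- The pairs of a function `w` and of the weighted difference quotient of its extension
by zero. -/
def gagliardoGraph (s : ℝ) (D : Set (E d)) (hΩ : MeasurableSet Ω) :
    Submodule ℝ (WithLp 2 (L2 Ω × Lp ℝ 2 (pairMeasure D))) where
  carrier := {x | x.snd =ᵐ[pairMeasure D] gagliardo s (Ω.indicator x.fst)}
  zero_mem' := by
    filter_upwards [Lp.coeFn_zero ℝ 2 (pairMeasure D),
      ae_pair (D := D) (ae_indicator hΩ (Lp.coeFn_zero ℝ 2 (volume.restrict Ω)))] with q hq h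
    simp only [WithLp.zero_snd, WithLp.zero_fst, hq, Pi.zero_apply, gagliardo]
    have e : ∀ x, (x ∈ Ω → (0 : L2 Ω) x = (0 : E d → ℝ) x) → Ω.indicator (0 : L2 Ω) x = 0 := by
      intro x hx
      by_cases h' : x ∈ Ω
      · rw [indicator_of_mem h', hx h', Pi.zero_apply]
      · rw [indicator_of_notMem h']
    rw [e _ h.1, e _ h.2]
    simp
  add_mem' := by
    intro a b ha hb
    filter_upwards [ha, hb, Lp.coeFn_add a.snd b.snd,
      ae_pair (D := D) (ae_indicator hΩ (Lp.coeFn_add a.fst b.fst))] with q ha hb hq h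
    have e : ∀ x, (x ∈ Ω → (a.fst + b.fst : L2 Ω) x = (a.fst + b.fst : E d → ℝ) x) →
        Ω.indicator (a.fst + b.fst : L2 Ω) x = Ω.indicator a.fst x + Ω.indicator b.fst x := by
      intro x hx
      by_cases h' : x ∈ Ω
      · simp only [indicator_of_mem h', hx h', Pi.add_apply]
      · simp only [indicator_of_notMem h', add_zero]
    simp only [WithLp.add_snd, WithLp.add_fst, hq, Pi.add_apply, gagliardo, ha, hb, e _ h.1,
      e _ h.2]
    ring
  smul_mem' := by
    intro c a ha
    filter_upwards [ha, Lp.coeFn_smul c a.snd,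
      ae_pair (D := D) (ae_indicator hΩ (Lp.coeFn_smul c a.fst))] with q ha hq h
    have e : ∀ x, (x ∈ Ω → (c • a.fst : L2 Ω) x = (c • a.fst : E d → ℝ) x) →
        Ω.indicator (c • a.fst : L2 Ω) x = c * Ω.indicator a.fst x := by
      intro x hx
      by_cases h' : x ∈ Ω <;> simp [h', hx]
    simp only [WithLp.smul_snd, WithLp.smul_fst, hq, Pi.smul_apply, smul_eq_mul, gagliardo, ha,
      e _ h.1, e _ h.2]
    ring

theorem exists_subseq_tendsto_ae {α : Type*} [MeasurableSpace α] {μ : Measure α}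
    {f : ℕ → Lp ℝ 2 μ} {g : Lp ℝ 2 μ} (h : Tendsto f atTop (𝓝 g)) :
    ∃ ns : ℕ → ℕ, StrictMono ns ∧ ∀ᵐ x ∂μ, Tendsto (fun i => f (ns i) x) atTop (𝓝 (g x)) :=
  (tendstoInMeasure_of_tendsto_Lp h).exists_seq_tendsto_ae

/-- The difference quotient is a pointwise expression, so it suffices to pass to a subsequence along
which both components converge almost everywhere. -/
theorem isClosed_gagliardoGraph (hΩ : MeasurableSet Ω) :
    IsClosed (gagliardoGraph s D hΩ : Set (WithLp 2 (L2 Ω × Lp ℝ 2 (pairMeasure D)))) := by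
  refine IsSeqClosed.isClosed fun x a hx hxa => ?_
  have h1 : Tendsto (fun n => (x n).fst) atTop (𝓝 a.fst) :=
    ((WithLp.fstL 2 ℝ (L2 Ω) (Lp ℝ 2 (pairMeasure D))).continuous.tendsto a).comp hxa
  have h2 : Tendsto (fun n => (x n).snd) atTop (𝓝 a.snd) :=
    ((WithLp.sndL 2 ℝ (L2 Ω) (Lp ℝ 2 (pairMeasure D))).continuous.tendsto a).comp hxa
  obtain ⟨ns, hns, hae1⟩ := exists_subseq_tendsto_ae h1
  obtain ⟨ms, hms, hae2⟩ := exists_subseq_tendsto_ae (h2.comp hns.tendsto_atTop)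
  have hx' : ∀ᵐ q ∂(pairMeasure D), ∀ n, (x n).snd q = gagliardo s (Ω.indicator (x n).fst) q :=
    ae_all_iff.2 hx
  change a.snd =ᵐ[pairMeasure D] gagliardo s (Ω.indicator a.fst)
  filter_upwards [hx', hae2, ae_pair (D := D) (ae_indicator hΩ hae1)] with q hq hq2 hq1
  refine tendsto_nhds_unique hq2 ?_
  have e : ∀ y, (y ∈ Ω → Tendsto (fun i => (x (ns i)).fst y) atTop (𝓝 (a.fst y))) →
      Tendsto (fun i => Ω.indicator (x (ns (ms i))).fst y) atTop (𝓝 (Ω.indicator a.fst y)) := by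
    intro y hy
    by_cases h' : y ∈ Ω
    · simpa [h', Function.comp_def] using (hy h').comp hms.tendsto_atTop
    · simp [h']
  simp only [Function.comp, hq]
  exact ((e _ hq1.1).sub (e _ hq1.2)).mul_const _

theorem gagliardoGraph_normSq (hs : s ∈ Ioo (0 : ℝ) 1) (hΩ : MeasurableSet Ω) (hΩD : Ω ⊆ D)
    {x : WithLp 2 (L2 Ω × Lp ℝ 2 (pairMeasure D))} (hx : x ∈ gagliardoGraph s D hΩ) :
    hsNormSq s D (Ω.indicator x.fst) = ENNReal.ofReal (‖x.fst‖ ^ 2 + ‖x.snd‖ ^ 2) := by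
  have hx : x.snd =ᵐ[pairMeasure D] gagliardo s (Ω.indicator x.fst) := hx
  rw [ENNReal.ofReal_add (sq_nonneg _) (sq_nonneg _), Lp_norm_sq_eq_lintegral x.snd, hsNormSq,
    lintegral_indicator_sq hΩ hΩD, ← lintegral_gagliardo_sq hs (measurable_indicator_coe hΩ _)]
  congr 1
  exact lintegral_congr_ae (hx.mono fun q hq => by simp only [hq])

theorem exists_mem_gagliardoGraph (hs : s ∈ Ioo (0 : ℝ) 1) (hΩ : MeasurableSet Ω) {w : L2 Ω}
    (hw : hsNormSq s D (Ω.indicator w) < ⊤) : ∃ x ∈ gagliardoGraph s D hΩ, x.fst = w := by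
  have hm := measurable_gagliardo (s := s) (measurable_indicator_coe hΩ w)
  have hL : MemLp (gagliardo s (Ω.indicator w)) 2 (pairMeasure D) := by
    rw [memLp_two_iff_integrable_sq hm.aestronglyMeasurable]
    refine ⟨(hm.pow_const 2).aestronglyMeasurable, ?_⟩
    rw [hasFiniteIntegral_iff_ofReal (Eventually.of_forall fun q => sq_nonneg _),
      lintegral_gagliardo_sq hs (measurable_indicator_coe hΩ w)]
    exact (self_le_add_left _ _).trans_lt hw
  exact ⟨WithLp.toLp 2 (w, hL.toLp _), hL.coeFn_toLp, rfl⟩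

/-- For t < r the balls of radius t around points of `innerSet Ω r` stay in Ω. There the deviation
from the averages is at most a constant times t^{2s} times the seminorm, uniformly in n, and no jump
of the extension by zero is seen. -/
theorem gagliardoGraph_compact [IsFiniteMeasure (volume.restrict Ω)] (hs : s ∈ Ioo (0 : ℝ) 1)
    (hΩ : MeasurableSet Ω) (hΩD : Ω ⊆ D)
    {x : ℕ → WithLp 2 (L2 Ω × Lp ℝ 2 (pairMeasure D))} {C : ℝ}
    (hx : ∀ n, x n ∈ gagliardoGraph s D hΩ) (hC : ∀ n, ‖x n‖ ≤ C) (hx0 : WeakConv x 0)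
    {r : ℝ} (hr : 0 < r) :
    Tendsto (fun n => ∫ z in innerSet Ω r, ((x n).fst z) ^ 2 ∂(volume.restrict Ω))
      atTop (𝓝 0) := by
  have hc := fracConst_pos d hs
  have hns : ∀ n, ‖(x n).fst‖ ^ 2 ≤ C ^ 2 ∧ ‖(x n).snd‖ ^ 2 ≤ C ^ 2 := fun n => by
    have h1 := WithLp.prod_norm_sq_eq_of_L2 (x n)
    have h2 := pow_le_pow_left₀ (norm_nonneg _) (hC n) 2
    constructor <;> nlinarith [sq_nonneg ‖(x n).fst‖, sq_nonneg ‖(x n).snd‖]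
  have hC0 : 0 ≤ C := (norm_nonneg _).trans (hC 0)
  refine tendsto_integral_sq_of_ballAvg (w := fun n => (x n).fst) (C := C)
    (fun n => le_of_sq_le_sq (hns n).1 hC0)
    (by simpa using hx0.map (WithLp.fstL 2 ℝ (L2 Ω) (Lp ℝ 2 (pairMeasure D)))) fun η hη => ?_
  have hlim := (tendsto_ball_inv_mul_rpow (d := d) hs.1).mul_const
    ((fracConst d s / 2)⁻¹ * C ^ 2)
  rw [zero_mul] at hlim
  obtain ⟨t, ht, ht0, htr⟩ := ((hlim.eventually (gt_mem_nhds hη)).and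
    (eventually_mem_nhdsWithin.and (eventually_nhdsWithin_of_eventually_nhds
      (gt_mem_nhds hr)))).exists
  have ht0 : 0 < t := ht0
  have htr : t < r := htr
  refine ⟨t, fun n => ?_⟩
  set v := Ω.indicator (x n).fst with hv
  have hSΩ : innerSet Ω r ⊆ Ω := innerSet_subset hr
  have hSm : MeasurableSet (innerSet Ω r) := (isClosed_innerSet Ω r).measurableSet
  have hball : ∀ z ∈ innerSet Ω r, Metric.ball z t ⊆ D := fun z hz =>
    ((Metric.ball_subset_ball htr.le).trans hz).trans hΩD
  have h1 := lintegral_sub_average_le (memLp_indicator_coe hΩ (x n).fst) hs.1.le ht0 hball hSm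
  -- The model absorbs the factor c_{d,s}/2 into the second component; it is divided out to recover
  -- the bare double integral.
  have hA : ∫⁻ z in D, ∫⁻ y in D, ENNReal.ofReal ((v z - v y) ^ 2 / ‖z - y‖ ^ ((d : ℝ) + 2 * s))
      = ENNReal.ofReal ((fracConst d s / 2)⁻¹ * ‖(x n).snd‖ ^ 2) := by
    have h2 := gagliardoGraph_normSq hs hΩ hΩD (hx n)
    rw [hsNormSq, lintegral_indicator_sq hΩ hΩD, ENNReal.ofReal_add (sq_nonneg _) (sq_nonneg _),
      ENNReal.add_right_inj ENNReal.ofReal_ne_top] at h2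
    rw [ENNReal.ofReal_mul (by positivity), ← h2, ← mul_assoc,
      ← ENNReal.ofReal_mul (by positivity), inv_mul_cancel₀ (half_pos hc).ne', ENNReal.ofReal_one,
      one_mul]
  rw [hA, ← ENNReal.ofReal_mul (mul_nonneg (inv_nonneg.2 measureReal_nonneg)
    (Real.rpow_nonneg ht0.le _))] at h1
  rw [Measure.restrict_restrict hSm, inter_eq_left.2 hSΩ]
  calc ∫⁻ z in innerSet Ω r, ENNReal.ofReal (((x n).fst z - ballAvg Ω t (x n).fst z) ^ 2)
      = ∫⁻ z in innerSet Ω r, ENNReal.ofReal ((v z -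
          (volume.real (Metric.ball (0 : E d) t))⁻¹ * ∫ y in Metric.ball z t, v y) ^ 2) := by
        refine setLIntegral_congr_fun hSm fun z hz => ?_
        simp only [ballAvg_eq_indicator hΩ, hv, indicator_of_mem (hSΩ hz)]
    _ ≤ _ := h1
    _ ≤ ENNReal.ofReal η := by
        refine ENNReal.ofReal_le_ofReal (le_trans ?_ ht.le)
        exact mul_le_mul_of_nonneg_left (mul_le_mul_of_nonneg_left (hns n).2 (by positivity))
          (mul_nonneg (inv_nonneg.2 measureReal_nonneg) (Real.rpow_nonneg ht0.le _))

/-- The model of a space whose norm is the `H^s(D)`-norm of the extension by zero. -/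
def gagliardoModel [IsFiniteMeasure (volume.restrict Ω)] (hs : s ∈ Ioo (0 : ℝ) 1)
    (hΩ : MeasurableSet Ω) (hΩD : Ω ⊆ D) (κ : SpaceKind)
    (hκ : ∀ w, wNormSq κ s Ω w = hsNormSq s D (Ω.indicator w))
    (hW : ∀ w, w ∈ W κ s Ω ↔ wNormSq κ s Ω w < ⊤) :
    SobolevModel κ s Ω (Lp ℝ 2 (pairMeasure D)) where
  θ := 1
  θ_nonneg := zero_le_one
  graph := gagliardoGraph s D hΩ
  isClosed := isClosed_gagliardoGraph hΩ
  mem_W w := by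
    rw [hW, hκ]
    refine ⟨exists_mem_gagliardoGraph hs hΩ, ?_⟩
    rintro ⟨x, hx, rfl⟩
    rw [gagliardoGraph_normSq hs hΩ hΩD hx]
    exact ENNReal.ofReal_lt_top
  normSq x hx := by rw [hκ, gagliardoGraph_normSq hs hΩ hΩD hx, one_mul]
  compact _ _ hx hC hx0 _ hr := gagliardoGraph_compact hs hΩ hΩD hx hC hx0 hr

theorem hsNormSq_indicator (hΩ : MeasurableSet Ω) (v : E d → ℝ) :
    hsNormSq s Ω v = hsNormSq s Ω (Ω.indicator v) :=
  hsNormSq_congr_ae (indicator_ae_eq_restrict hΩ).symm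

/-! ### Test functions and the closed subspace of H^s_0 -/

theorem IsTestFunction.memLp {φ : E d → ℝ} (h : IsTestFunction Ω φ) (μ : Measure (E d))
    [IsFiniteMeasureOnCompacts μ] : MemLp φ 2 μ :=
  h.1.continuous.memLp_of_hasCompactSupport h.2.1

theorem IsTestFunction.zero : IsTestFunction Ω (0 : E d → ℝ) :=
  ⟨contDiff_const, HasCompactSupport.zero, by simp [tsupport]⟩

theorem IsTestFunction.add {φ χ : E d → ℝ} (h : IsTestFunction Ω φ) (h' : IsTestFunction Ω χ) :
    IsTestFunction Ω (φ + χ) :=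
  ⟨h.1.add h'.1, h.2.1.add h'.2.1, (tsupport_add φ χ).trans (union_subset h.2.2 h'.2.2)⟩

theorem IsTestFunction.smul {φ : E d → ℝ} (c : ℝ) (h : IsTestFunction Ω φ) :
    IsTestFunction Ω (c • φ) :=
  ⟨h.1.const_smul c, h.2.1.smul_left (f := fun _ => c),
    (tsupport_smul_subset_right (fun _ => c) φ).trans h.2.2⟩

/-- The elements of `L²(Ω) × H` whose first component is a test function. -/
def testPairs (Ω : Set (E d)) (H : Type) [NormedAddCommGroup H] [InnerProductSpace ℝ H] :
    Submodule ℝ (WithLp 2 (L2 Ω × H)) where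
  carrier := {x | ∃ φ, IsTestFunction Ω φ ∧ x.fst =ᵐ[volume.restrict Ω] φ}
  zero_mem' := ⟨0, IsTestFunction.zero, Lp.coeFn_zero ℝ 2 _⟩
  add_mem' := by
    rintro a b ⟨φ, hφ, ha⟩ ⟨χ, hχ, hb⟩
    exact ⟨φ + χ, hφ.add hχ, (Lp.coeFn_add _ _).trans (ha.add hb)⟩
  smul_mem' := by
    rintro c a ⟨φ, hφ, ha⟩
    exact ⟨c • φ, hφ.smul c, (Lp.coeFn_smul _ _).trans (ha.const_smul c)⟩

/-- On the Gagliardo graph the Hilbert norm of a pair is the H^s-norm of its first component, so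
closure in the graph is approximation in H^s(Ω). -/
theorem mem_closure_testPairs_iff [IsFiniteMeasure (volume.restrict Ω)] (hs : s ∈ Ioo (0 : ℝ) 1)
    (hΩ : MeasurableSet Ω) {x : WithLp 2 (L2 Ω × Lp ℝ 2 (pairMeasure Ω))}
    (hx : x ∈ gagliardoGraph s Ω hΩ) :
    x ∈ (gagliardoGraph s Ω hΩ ⊓ testPairs Ω _).topologicalClosure ↔
      ∀ δ : ℝ≥0∞, 0 < δ → ∃ φ : E d → ℝ, IsTestFunction Ω φ ∧
        hsNormSq s Ω (fun y => x.fst y - φ y) < δ := by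
  have hnorm : ∀ y ∈ gagliardoGraph s Ω hΩ,
      hsNormSq s Ω y.fst = ENNReal.ofReal (‖y‖ ^ 2) := fun y hy => by
    rw [hsNormSq_indicator hΩ, gagliardoGraph_normSq hs hΩ Subset.rfl hy,
      WithLp.prod_norm_sq_eq_of_L2]
  rw [← SetLike.mem_coe, Submodule.topologicalClosure_coe]
  constructor
  · intro h δ hδ
    obtain ⟨y, hy, hyx⟩ := mem_closure_iff_seq_limit.1 h
    have hlim : Tendsto (fun n => ENNReal.ofReal (‖x - y n‖ ^ 2)) atTop (𝓝 0) := by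
      have := ENNReal.tendsto_ofReal (((tendsto_const_nhds (x := x)).sub hyx).norm.pow 2)
      simpa using this
    obtain ⟨n, hn⟩ := (hlim.eventually (gt_mem_nhds hδ)).exists
    obtain ⟨φ, hφ, hyφ⟩ := (hy n).2
    refine ⟨φ, hφ, ?_⟩
    rw [← hnorm _ (sub_mem hx (hy n).1)] at hn
    rwa [hsNormSq_congr_ae (v' := (x - y n).fst)]
    filter_upwards [Lp.coeFn_sub x.fst (y n).fst, hyφ] with z h1 h2
    rw [WithLp.sub_fst, h1, Pi.sub_apply, h2]
  · intro h
    refine Metric.mem_closure_iff.2 fun e he => ?_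
    obtain ⟨φ, hφ, hlt⟩ := h (ENNReal.ofReal (e ^ 2)) (by rw [ENNReal.ofReal_pos]; positivity)
    have hφL := hφ.memLp (volume.restrict Ω)
    have hae : (x.fst - hφL.toLp φ : L2 Ω) =ᵐ[volume.restrict Ω] fun y => x.fst y - φ y := by
      filter_upwards [Lp.coeFn_sub x.fst (hφL.toLp φ), hφL.coeFn_toLp] with z h1 h2
      rw [h1, Pi.sub_apply, h2]
    rw [← hsNormSq_congr_ae hae] at hlt
    -- Lift x - φ rather than φ: its H^s-norm is known to be finite, and x - x' is then a test pair
    -- at distance ‖x'‖ from x.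
    obtain ⟨x', hx', hx'e⟩ := exists_mem_gagliardoGraph (D := Ω) hs hΩ
      (w := x.fst - hφL.toLp φ) (by
        rw [← hsNormSq_indicator hΩ]; exact hlt.trans ENNReal.ofReal_lt_top)
    refine ⟨x - x', ⟨sub_mem hx hx', φ, hφ, ?_⟩, ?_⟩
    · rw [WithLp.sub_fst, hx'e, sub_sub_cancel]
      exact hφL.coeFn_toLp
    · rw [← hx'e, hnorm _ hx', ENNReal.ofReal_lt_ofReal_iff (by positivity)] at hlt
      rw [dist_eq_norm, sub_sub_cancel]
      exact lt_of_pow_lt_pow_left₀ 2 he.le hlt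

/-- The model of `H₀^s(Ω)`. -/
def zeroModel [IsFiniteMeasure (volume.restrict Ω)] (hs : s ∈ Ioo (0 : ℝ) 1)
    (hΩ : MeasurableSet Ω) : SobolevModel .zero s Ω (Lp ℝ 2 (pairMeasure Ω)) :=
  have hle : (gagliardoGraph s Ω hΩ ⊓ testPairs Ω (Lp ℝ 2 (pairMeasure Ω))).topologicalClosure ≤
      gagliardoGraph s Ω hΩ :=
    Submodule.topologicalClosure_minimal _ inf_le_left (isClosed_gagliardoGraph hΩ)
  have hnorm : ∀ w : L2 Ω, wNormSq .zero s Ω w = hsNormSq s Ω (Ω.indicator w) :=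
    fun w => hsNormSq_indicator hΩ w
  { θ := 1
    θ_nonneg := zero_le_one
    graph := (gagliardoGraph s Ω hΩ ⊓ testPairs Ω _).topologicalClosure
    isClosed := Submodule.isClosed_topologicalClosure _
    mem_W := fun w => by
      constructor
      · rintro ⟨h1, h2⟩
        rw [hnorm] at h1
        obtain ⟨x, hx, rfl⟩ := exists_mem_gagliardoGraph hs hΩ h1
        exact ⟨x, (mem_closure_testPairs_iff hs hΩ hx).2 h2, rfl⟩
      · rintro ⟨x, hx, rfl⟩
        refine ⟨?_, (mem_closure_testPairs_iff hs hΩ (hle hx)).1 hx⟩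
        rw [hnorm, gagliardoGraph_normSq hs hΩ Subset.rfl (hle hx)]
        exact ENNReal.ofReal_lt_top
    normSq := fun x hx => by
      rw [hnorm, gagliardoGraph_normSq hs hΩ Subset.rfl (hle hx), one_mul]
    compact := fun _ _ hx hC hx0 _ hr =>
      gagliardoGraph_compact hs hΩ Subset.rfl (fun n => hle (hx n)) hC hx0 hr }

end Gagliardo

/-! ### Compactness of the embedding of `H¹₀(Ω)` into `L²(Ω)` -/

section TestFunctions

variable {d : ℕ} {Ω : Set (E d)} {φ : E d → ℝ}

theorem continuous_gradient (hφ : ContDiff ℝ ∞ φ) : Continuous (gradient φ) :=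
  (InnerProductSpace.toDual ℝ (E d)).symm.continuous.comp
    (hφ.continuous_fderiv (by simp))

theorem inner_gradient (x h : E d) : ⟪gradient φ x, h⟫_ℝ = fderiv ℝ φ x h := by
  rw [gradient, InnerProductSpace.toDual_symm_apply]

/-- Fundamental theorem of calculus along the segment from x to x + h, then Cauchy–Schwarz in t and
in ℝ^d. -/
theorem sq_sub_translate_le (hφ : ContDiff ℝ ∞ φ) (x h : E d) :
    ENNReal.ofReal ((φ x - φ (x + h)) ^ 2) ≤ ENNReal.ofReal (‖h‖ ^ 2) *
      ∫⁻ t in Ioc (0 : ℝ) 1, ENNReal.ofReal (‖gradient φ (x + t • h)‖ ^ 2) := by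
  set g : ℝ → ℝ := fun t => ⟪gradient φ (x + t • h), h⟫_ℝ with hg
  have hline : Continuous fun t : ℝ => x + t • h := by fun_prop
  have hgrad : Continuous fun t : ℝ => gradient φ (x + t • h) :=
    (continuous_gradient hφ).comp hline
  have hgc : Continuous g := hgrad.inner continuous_const
  have hderiv : ∀ t ∈ uIcc (0 : ℝ) 1, HasDerivAt (fun t : ℝ => φ (x + t • h)) (g t) t := by
    intro t _
    have h1 : HasDerivAt (fun t : ℝ => x + t • h) h t := by
      simpa using ((hasDerivAt_id t).smul_const h).const_add x
    have h2 := ((hφ.differentiable (by simp)).differentiableAt (x := x + t • h)).hasFDerivAt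
    simpa only [hg, inner_gradient, Function.comp_def] using h2.comp_hasDerivAt t h1
  have hFTC : ∫ t in (0 : ℝ)..1, g t = φ (x + h) - φ x := by
    rw [intervalIntegral.integral_eq_sub_of_hasDerivAt hderiv (hgc.intervalIntegrable _ _)]
    simp
  set m := φ (x + h) - φ x with hm
  have hCS : m ^ 2 ≤ ∫ t in (0 : ℝ)..1, (g t) ^ 2 := by
    -- The variance of g on [0, 1] is nonnegative and its mean is m.
    have h0 : 0 ≤ ∫ t in (0 : ℝ)..1, (g t - m) ^ 2 :=
      intervalIntegral.integral_nonneg zero_le_one fun t _ => sq_nonneg _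
    have e : ∀ t, (g t - m) ^ 2 = (g t) ^ 2 - (2 * m * g t - m ^ 2) := fun t => by ring
    simp only [e] at h0
    have i1 : IntervalIntegrable (fun t => (g t) ^ 2) volume 0 1 :=
      (hgc.pow 2).intervalIntegrable _ _
    have i2 : IntervalIntegrable (fun t => 2 * m * g t) volume 0 1 :=
      (hgc.const_mul (2 * m)).intervalIntegrable _ _
    have i3 : IntervalIntegrable (fun _ => m ^ 2) volume (0 : ℝ) 1 :=
      continuous_const.intervalIntegrable _ _
    rw [intervalIntegral.integral_sub i1 (i2.sub i3), intervalIntegral.integral_sub i2 i3,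
      intervalIntegral.integral_const_mul,
      hFTC, intervalIntegral.integral_const] at h0
    simp only [sub_zero, one_smul] at h0
    linarith
  have hCS2 : m ^ 2 ≤ ‖h‖ ^ 2 * ∫ t in Ioc (0 : ℝ) 1, ‖gradient φ (x + t • h)‖ ^ 2 := by
    refine hCS.trans ?_
    rw [← intervalIntegral.integral_of_le zero_le_one, ← intervalIntegral.integral_const_mul]
    refine intervalIntegral.integral_mono zero_le_one ((hgc.pow 2).intervalIntegrable _ _)
      (((hgrad.norm.pow 2).const_mul _).intervalIntegrable _ _) fun t => ?_
    have := real_inner_mul_inner_self_le (gradient φ (x + t • h)) h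
    rw [real_inner_self_eq_norm_sq, real_inner_self_eq_norm_sq] at this
    simp only [hg]
    nlinarith
  have hint : IntegrableOn (fun t : ℝ => ‖gradient φ (x + t • h)‖ ^ 2) (Ioc 0 1) :=
    ((hgrad.norm.pow 2).integrableOn_Icc (a := 0) (b := 1)).mono_set Ioc_subset_Icc_self
  rw [← ofReal_integral_eq_lintegral_ofReal hint (Eventually.of_forall fun t => sq_nonneg _),
    ← ENNReal.ofReal_mul (sq_nonneg _)]
  refine ENNReal.ofReal_le_ofReal (le_trans (le_of_eq ?_) hCS2)
  rw [hm]; ring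

/-- After Tonelli, translation invariance removes t from the inner integral. -/
theorem lintegral_sq_sub_translate_le (hφ : ContDiff ℝ ∞ φ) (h : E d) :
    ∫⁻ x, ENNReal.ofReal ((φ x - φ (x + h)) ^ 2) ≤ ENNReal.ofReal (‖h‖ ^ 2) *
      ∫⁻ x, ENNReal.ofReal (‖gradient φ x‖ ^ 2) := by
  have hgm : Measurable fun x => ENNReal.ofReal (‖gradient φ x‖ ^ 2) :=
    ((continuous_gradient hφ).norm.pow 2).measurable.ennreal_ofReal
  refine (lintegral_mono fun x => sq_sub_translate_le hφ x h).trans ?_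
  rw [lintegral_const_mul' _ _ ENNReal.ofReal_ne_top]
  refine mul_le_mul_right ?_ _
  rw [lintegral_lintegral_swap (f := fun (x : E d) (t : ℝ) =>
    ENNReal.ofReal (‖gradient φ (x + t • h)‖ ^ 2)) (by
      refine Measurable.aemeasurable ?_
      exact hgm.comp (by fun_prop : Measurable fun q : E d × ℝ => q.1 + q.2 • h))]
  have e : ∀ t : ℝ, ∫⁻ x, ENNReal.ofReal (‖gradient φ (x + t • h)‖ ^ 2) =
      ∫⁻ x, ENNReal.ofReal (‖gradient φ x‖ ^ 2) := fun t =>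
    lintegral_add_right_eq_self (fun x => ENNReal.ofReal (‖gradient φ x‖ ^ 2)) (t • h)
  simp only [e]
  rw [setLIntegral_const]
  simp

/-- Jensen's inequality, followed by the translation estimate averaged over ‖h‖ < r. -/
theorem lintegral_sub_average_le_gradient (hφ : ContDiff ℝ ∞ φ) (hc : HasCompactSupport φ) {r : ℝ}
    (hr : 0 < r) :
    ∫⁻ x, ENNReal.ofReal ((φ x - (volume.real (Metric.ball (0 : E d) r))⁻¹ *
        ∫ y in Metric.ball x r, φ y) ^ 2) ≤
      ENNReal.ofReal (r ^ 2) * ∫⁻ x, ENNReal.ofReal (‖gradient φ x‖ ^ 2) := by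
  have hφ2 : MemLp φ 2 volume := hφ.continuous.memLp_of_hasCompactSupport hc
  have hBtop : volume (Metric.ball (0 : E d) r) ≠ ⊤ := measure_ball_lt_top.ne
  have hBpos : volume (Metric.ball (0 : E d) r) ≠ 0 := (Metric.measure_ball_pos _ _ hr).ne'
  have e : ∀ x, ∫⁻ y in Metric.ball x r, ENNReal.ofReal ((φ x - φ y) ^ 2) =
      ∫⁻ h in Metric.ball (0 : E d) r, ENNReal.ofReal ((φ x - φ (x + h)) ^ 2) := fun x => by
    rw [← lintegral_indicator measurableSet_ball, ← lintegral_indicator measurableSet_ball,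
      ← lintegral_add_left_eq_self _ x]
    refine lintegral_congr fun h => ?_
    simp [indicator, Metric.mem_ball, dist_eq_norm]
  refine (lintegral_mono fun x => (sq_sub_average_le hφ2 x hr).trans_eq (by rw [e x])).trans ?_
  rw [lintegral_const_mul' _ _ ENNReal.ofReal_ne_top, lintegral_lintegral_swap (f :=
    fun (x : E d) (h : E d) => ENNReal.ofReal ((φ x - φ (x + h)) ^ 2)) (by
      refine Measurable.aemeasurable ?_
      have := hφ.continuous
      refine Measurable.ennreal_ofReal (Continuous.measurable ?_)
      fun_prop)]
  calc _ ≤ ENNReal.ofReal (volume.real (Metric.ball (0 : E d) r))⁻¹ *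
        ∫⁻ _ in Metric.ball (0 : E d) r,
          ENNReal.ofReal (r ^ 2) * ∫⁻ x, ENNReal.ofReal (‖gradient φ x‖ ^ 2) := by
        refine mul_le_mul_right (setLIntegral_mono' measurableSet_ball fun h hh => ?_) _
        refine (lintegral_sq_sub_translate_le hφ h).trans (mul_le_mul_left ?_ _)
        exact ENNReal.ofReal_le_ofReal (pow_le_pow_left₀ (norm_nonneg _)
          (by simpa using (Metric.mem_ball.1 hh).le) 2)
    _ = _ := by
        rw [setLIntegral_const, mul_comm (_ * _) (volume _), ← mul_assoc,
          ENNReal.ofReal_inv_of_pos (show 0 < volume.real (Metric.ball (0 : E d) r) from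
            ENNReal.toReal_pos hBpos hBtop), ofReal_measureReal hBtop,
          ENNReal.inv_mul_cancel hBpos hBtop, one_mul]

theorem IsTestFunction.eq_zero (h : IsTestFunction Ω φ) {x : E d} (hx : x ∉ Ω) : φ x = 0 :=
  image_eq_zero_of_notMem_tsupport fun h' => hx (h.2.2 h')

theorem IsTestFunction.gradient_eq_zero (h : IsTestFunction Ω φ) {x : E d} (hx : x ∉ Ω) :
    gradient φ x = 0 := by
  have : fderiv ℝ φ x = 0 := by
    by_contra h'
    exact hx (h.2.2 (support_fderiv_subset ℝ h'))
  rw [gradient, this, map_zero]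

theorem IsTestFunction.hasCompactSupport_gradient (h : IsTestFunction Ω φ) :
    HasCompactSupport (gradient φ) :=
  (h.2.1.fderiv ℝ).comp_left (map_zero (InnerProductSpace.toDual ℝ (E d)).symm)

theorem IsTestFunction.memLp_gradient (h : IsTestFunction Ω φ) (μ : Measure (E d))
    [IsFiniteMeasureOnCompacts μ] : MemLp (gradient φ) 2 μ :=
  (continuous_gradient h.1).memLp_of_hasCompactSupport h.hasCompactSupport_gradient

theorem gradient_add_of_contDiff {φ χ : E d → ℝ} (hφ : ContDiff ℝ ∞ φ) (hχ : ContDiff ℝ ∞ χ)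
    (x : E d) : gradient (φ + χ) x = gradient φ x + gradient χ x := by
  simp only [gradient]
  rw [fderiv_add (hφ.differentiable (by simp)).differentiableAt
    (hχ.differentiable (by simp)).differentiableAt, map_add]

theorem gradient_smul_of_contDiff {φ : E d → ℝ} (hφ : ContDiff ℝ ∞ φ) (c : ℝ)
    (x : E d) : gradient (c • φ) x = c • gradient φ x := by
  simp only [gradient]
  rw [fderiv_const_smul (hφ.differentiable (by simp)).differentiableAt]
  simp

theorem L2Vec_norm_sq_eq_lintegral (g : L2Vec Ω) :
    ENNReal.ofReal (‖g‖ ^ 2) = ∫⁻ x in Ω, ENNReal.ofReal (‖g x‖ ^ 2) := by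
  have h : ‖g‖ ^ 2 = ∫ x in Ω, ‖g x‖ ^ 2 := by
    rw [← real_inner_self_eq_norm_sq, L2.inner_def]
    simp only [real_inner_self_eq_norm_sq]
  rw [h, ofReal_integral_eq_lintegral_ofReal (Lp.memLp g).norm.integrable_sq
    (Eventually.of_forall fun x => sq_nonneg _)]

/-- The pairs `(φ, ∇φ)` with a test function `φ`. -/
def testGraph (Ω : Set (E d)) : Submodule ℝ (WithLp 2 (L2 Ω × L2Vec Ω)) where
  carrier := {x | ∃ φ : E d → ℝ, IsTestFunction Ω φ ∧
    x.fst =ᵐ[volume.restrict Ω] φ ∧ x.snd =ᵐ[volume.restrict Ω] fun x => gradient φ x}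
  zero_mem' := ⟨0, IsTestFunction.zero, Lp.coeFn_zero ℝ 2 _, by
    filter_upwards [Lp.coeFn_zero (E d) 2 (volume.restrict Ω)] with x hx
    rw [WithLp.zero_snd, hx]
    simp [gradient]⟩
  add_mem' := by
    rintro a b ⟨φ, hφ, ha, ha'⟩ ⟨χ, hχ, hb, hb'⟩
    refine ⟨φ + χ, hφ.add hχ, (Lp.coeFn_add _ _).trans (ha.add hb), ?_⟩
    filter_upwards [Lp.coeFn_add a.snd b.snd, ha', hb'] with x h1 h2 h3
    rw [WithLp.add_snd, h1, Pi.add_apply, h2, h3, gradient_add_of_contDiff hφ.1 hχ.1]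
  smul_mem' := by
    rintro c a ⟨φ, hφ, ha, ha'⟩
    refine ⟨c • φ, hφ.smul c, (Lp.coeFn_smul _ _).trans (ha.const_smul c), ?_⟩
    filter_upwards [Lp.coeFn_smul c a.snd, ha'] with x h1 h2
    rw [WithLp.smul_snd, h1, Pi.smul_apply, h2, gradient_smul_of_contDiff hφ.1]

/-- `H¹₀(Ω)`, as a closed subspace of the Hilbert space `L²(Ω) × L²(Ω; ℝ^d)`. -/
abbrev h10 (Ω : Set (E d)) : Submodule ℝ (WithLp 2 (L2 Ω × L2Vec Ω)) :=
  (testGraph Ω).topologicalClosure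

/-- `WithLp 2` changes the norm of the product but not its topology, so the two closures agree. -/
theorem mem_h10_iff {x : WithLp 2 (L2 Ω × L2Vec Ω)} :
    x ∈ h10 Ω ↔ (x.fst, x.snd) ∈ h10Graph Ω := by
  have h := (WithLp.prodContinuousLinearEquiv 2 ℝ (L2 Ω) (L2Vec Ω)).toHomeomorph.preimage_closure
    {q | ∃ φ : E d → ℝ, IsTestFunction Ω φ ∧
      q.1 =ᵐ[volume.restrict Ω] φ ∧ q.2 =ᵐ[volume.restrict Ω] fun x => gradient φ x}
  exact (Set.ext_iff.1 h x).symm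

/-- A test function extended by zero is smooth on the whole space, so the estimate holds on all of Ω
and not only on inner sets. -/
theorem lintegral_sub_ballAvg_le_of_mem_testGraph (hΩ : MeasurableSet Ω)
    {x : WithLp 2 (L2 Ω × L2Vec Ω)} (hx : x ∈ testGraph Ω) {r : ℝ} (hr : 0 < r) :
    ∫⁻ z in Ω, ENNReal.ofReal ((x.fst z - ballAvg Ω r x.fst z) ^ 2) ≤
      ENNReal.ofReal (r ^ 2 * ‖x.snd‖ ^ 2) := by
  obtain ⟨φ, hφ, h1, h2⟩ := hx
  have hind : Ω.indicator x.fst =ᵐ[volume] φ := by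
    filter_upwards [ae_indicator hΩ h1] with z hz
    by_cases h : z ∈ Ω
    · rw [indicator_of_mem h, hz h]
    · rw [indicator_of_notMem h, hφ.eq_zero h]
  have hgrad : ∫⁻ z, ENNReal.ofReal (‖gradient φ z‖ ^ 2) = ENNReal.ofReal (‖x.snd‖ ^ 2) := by
    rw [L2Vec_norm_sq_eq_lintegral, ← lintegral_indicator hΩ]
    refine lintegral_congr_ae ?_
    filter_upwards [ae_indicator hΩ h2] with z hz
    by_cases h : z ∈ Ω
    · rw [indicator_of_mem h, hz h]
    · rw [indicator_of_notMem h, hφ.gradient_eq_zero h]; simp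
  rw [ENNReal.ofReal_mul (sq_nonneg r), ← hgrad]
  refine le_trans ?_ (lintegral_sub_average_le_gradient hφ.1 hφ.2.1 hr)
  refine le_trans (le_of_eq ?_) (lintegral_mono' (Measure.restrict_le_self (s := Ω)) le_rfl)
  refine lintegral_congr_ae ?_
  filter_upwards [h1] with z hz
  rw [hz, ballAvg_eq_indicator hΩ, setIntegral_congr_ae measurableSet_ball
    (hind.mono fun y hy _ => hy)]

/-- Rellich's theorem for `H¹₀(Ω)`. -/
theorem tendsto_fst_of_mem_h10 [IsFiniteMeasure (volume.restrict Ω)] (hΩ : MeasurableSet Ω)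
    (x : ℕ → WithLp 2 (L2 Ω × L2Vec Ω)) (C : ℝ) (hx : ∀ n, x n ∈ h10 Ω) (hC : ∀ n, ‖x n‖ ≤ C)
    (hx0 : WeakConv x 0) : Tendsto (fun n => (x n).fst) atTop (𝓝 0) := by
  -- The averaging estimate is available for test pairs, so each x_n is replaced by one within
  -- 1/(n+1). Weak convergence and boundedness are inherited.
  have happ : ∀ n : ℕ, ∃ y ∈ testGraph Ω, ‖x n - y‖ <
      1 / ((n : ℝ) + 1) := fun n => by
    obtain ⟨y, hy, h⟩ := Metric.mem_closure_iff.1 (hx n) (1 / ((n : ℝ) + 1)) (by positivity)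
    exact ⟨y, hy, by rwa [dist_eq_norm] at h⟩
  choose y hy hxy using happ
  have hdiff : Tendsto (fun n => x n - y n) atTop (𝓝 0) :=
    squeeze_zero_norm (fun n => (hxy n).le) tendsto_one_div_add_atTop_nhds_zero_nat
  have hdiff1 : Tendsto (fun n => (x n - y n).fst) atTop (𝓝 0) := by
    simpa [Function.comp_def] using
      ((WithLp.fstL 2 ℝ (L2 Ω) (L2Vec Ω)).continuous.tendsto 0).comp hdiff
  have hyC : ∀ n, ‖y n‖ ≤ C + 1 := fun n => by
    calc ‖y n‖ = ‖x n - (x n - y n)‖ := by congr 1; abel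
      _ ≤ ‖x n‖ + ‖x n - y n‖ := norm_sub_le _ _
      _ ≤ C + 1 := add_le_add (hC n) ((hxy n).le.trans (by
          rw [div_le_one (by positivity)]; linarith [n.cast_nonneg (α := ℝ)]))
  have hC1 : 0 ≤ C + 1 := (norm_nonneg _).trans (hyC 0)
  have hyn : ∀ n, ‖(y n).fst‖ ^ 2 ≤ (C + 1) ^ 2 ∧ ‖(y n).snd‖ ^ 2 ≤ (C + 1) ^ 2 := fun n => by
    have h1 := WithLp.prod_norm_sq_eq_of_L2 (y n)
    have h2 := pow_le_pow_left₀ (norm_nonneg _) (hyC n) 2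
    constructor <;> nlinarith [sq_nonneg ‖(y n).fst‖, sq_nonneg ‖(y n).snd‖]
  have hyw : WeakConv (fun n => (y n).fst) 0 := by
    have h1 : WeakConv (fun n => (x n - y n).fst) 0 := fun v => by
      simpa using hdiff1.inner (tendsto_const_nhds (x := v))
    have h2 : WeakConv (fun n => (x n).fst) 0 := by
      simpa using hx0.map (WithLp.fstL 2 ℝ (L2 Ω) (L2Vec Ω))
    have h3 := h2.sub h1
    rw [sub_zero] at h3
    convert h3 using 2 with n
    rw [WithLp.sub_fst]
    exact (sub_sub_cancel _ _).symm
  have hylim : Tendsto (fun n => (y n).fst) atTop (𝓝 0) := by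
    have h1 := tendsto_integral_sq_of_ballAvg (S := Ω) (w := fun n => (y n).fst)
      (fun n => le_of_sq_le_sq (hyn n).1 hC1) hyw (fun η hη => by
        have hlim : Tendsto (fun r : ℝ => r ^ 2 * (C + 1) ^ 2) (𝓝[>] 0) (𝓝 0) := by
          have : Continuous fun r : ℝ => r ^ 2 * (C + 1) ^ 2 := by fun_prop
          simpa using (this.tendsto 0).mono_left (nhdsWithin_le_nhds (s := Ioi 0))
        obtain ⟨r, hr, hr0⟩ := ((hlim.eventually (gt_mem_nhds hη)).and
          eventually_mem_nhdsWithin).exists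
        refine ⟨r, fun n => ?_⟩
        rw [Measure.restrict_restrict hΩ, inter_self]
        refine (lintegral_sub_ballAvg_le_of_mem_testGraph hΩ (hy n) hr0).trans
          (ENNReal.ofReal_le_ofReal (le_trans ?_ hr.le))
        exact mul_le_mul_of_nonneg_left (hyn n).2 (sq_nonneg _))
    rw [Measure.restrict_restrict hΩ, inter_self] at h1
    rw [tendsto_zero_iff_norm_tendsto_zero]
    have h2 := h1.sqrt
    rw [Real.sqrt_zero] at h2
    refine h2.congr fun n => ?_
    rw [← Lp_norm_sq, Real.sqrt_sq (norm_nonneg _)]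
  have := hdiff1.add hylim
  rw [add_zero] at this
  refine this.congr fun n => ?_
  rw [WithLp.sub_fst, sub_add_cancel]

end TestFunctions

/-! ### Orthogonal decompositions -/

section Decomposition

variable {X ι : Type*} [NormedAddCommGroup X] [InnerProductSpace ℝ X]
  {F : ι → Submodule ℝ X} [∀ i, CompleteSpace (F i)]

/-- Pairing the sum with an element of `F i` annihilates every term but the i-th. -/
theorem orthogonalProjectionOnto_eq_of_hasSum
    (hF : OrthogonalFamily ℝ (fun i => F i) fun i => (F i).subtypeₗᵢ) {f : ∀ i, F i} {w : X}
    (hw : HasSum (fun i => (f i : X)) w) (i : ι) : (F i).orthogonalProjectionOnto w = f i := by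
  refine ext_inner_right ℝ fun e => ?_
  have h1 : ⟪(F i).orthogonalProjectionOnto w, e⟫_ℝ = ⟪w, (e : X)⟫_ℝ :=
    Submodule.inner_orthogonalProjectionOnto_eq_of_mem_right e w
  have h2 : HasSum (fun j => ⟪(f j : X), (e : X)⟫_ℝ) ⟪w, (e : X)⟫_ℝ := by
    simpa only [innerSL_apply_apply, real_inner_comm] using hw.mapL (innerSL ℝ (e : X))
  have h3 : HasSum (fun j => ⟪(f j : X), (e : X)⟫_ℝ) ⟪(f i : X), (e : X)⟫_ℝ :=
    hasSum_single i fun j hj => hF hj (f j) e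
  rw [h1, h2.unique h3]
  rfl

variable [CompleteSpace X]

theorem IsHilbertSum.hasSum_norm_sq
    (hF : IsHilbertSum ℝ (fun i => F i) fun i => (F i).subtypeₗᵢ) (w : X) :
    HasSum (fun i => ‖(F i).orthogonalProjectionOnto w‖ ^ 2) (‖w‖ ^ 2) := by
  set f : lp (fun i => F i) 2 := hF.linearIsometryEquiv w with hf
  have h1 : HasSum (fun i => ((f i : F i) : X)) w := by
    have := hF.hasSum_linearIsometryEquiv_symm f
    simpa [hf] using this
  have h2 : ∀ i, (F i).orthogonalProjectionOnto w = f i :=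
    orthogonalProjectionOnto_eq_of_hasSum hF.OrthogonalFamily h1
  have h3 := lp.hasSum_inner (𝕜 := ℝ) f f
  rw [real_inner_self_eq_norm_sq, hf, LinearIsometryEquiv.norm_map] at h3
  simpa only [h2, real_inner_self_eq_norm_sq] using h3

/-- Riesz–Fischer: square summable components come from a vector. -/
theorem IsHilbertSum.exists_orthogonalProjectionOnto_eq
    (hF : IsHilbertSum ℝ (fun i => F i) fun i => (F i).subtypeₗᵢ) {f : ∀ i, F i}
    (hf : Summable fun i => ‖f i‖ ^ 2) : ∃ h : X, ∀ i, (F i).orthogonalProjectionOnto h = f i := by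
  have hmem : Memℓp f 2 := memℓp_gen (by simpa using hf)
  exact ⟨_, orthogonalProjectionOnto_eq_of_hasSum hF.OrthogonalFamily
    (hF.hasSum_linearIsometryEquiv_symm ⟨f, hmem⟩)⟩

end Decomposition

/-! ### The operator `L L*` -/

section Adjoint

variable {X Y : Type*} [NormedAddCommGroup X] [InnerProductSpace ℝ X] [CompleteSpace X]
  [NormedAddCommGroup Y] [InnerProductSpace ℝ Y] [CompleteSpace Y]

/-- The operator `L L*`. -/
def mulAdjoint (L : Y →L[ℝ] X) : X →L[ℝ] X := L.comp (ContinuousLinearMap.adjoint L)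

variable {L : Y →L[ℝ] X}

theorem inner_mulAdjoint (v w : X) : ⟪mulAdjoint L v, w⟫_ℝ =
    ⟪ContinuousLinearMap.adjoint L v, ContinuousLinearMap.adjoint L w⟫_ℝ :=
  (ContinuousLinearMap.adjoint_inner_right L (ContinuousLinearMap.adjoint L v) w).symm

theorem isSymmetric_mulAdjoint : (mulAdjoint L).IsSymmetric := fun v w => by
  change ⟪mulAdjoint L v, w⟫_ℝ = ⟪v, mulAdjoint L w⟫_ℝ
  rw [inner_mulAdjoint, real_inner_comm _ v, inner_mulAdjoint, real_inner_comm]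

theorem isCompactOperator_mulAdjoint [SecondCountableTopology Y]
    (hL : ∀ (x : ℕ → Y) (C : ℝ), (∀ n, ‖x n‖ ≤ C) → WeakConv x 0 →
      Tendsto (fun n => L (x n)) atTop (𝓝 0)) : IsCompactOperator (mulAdjoint L) :=
  (isCompactOperator_of_weakConv L hL).comp_clm _

theorem tendsto_mulAdjoint
    (hL : ∀ (x : ℕ → Y) (C : ℝ), (∀ n, ‖x n‖ ≤ C) → WeakConv x 0 →
      Tendsto (fun n => L (x n)) atTop (𝓝 0))
    {w : ℕ → X} {C : ℝ} (hC : ∀ n, ‖w n‖ ≤ C) (hw : WeakConv w 0) :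
    Tendsto (fun n => mulAdjoint L (w n)) atTop (𝓝 0) := by
  refine hL (fun n => ContinuousLinearMap.adjoint L (w n))
    (‖ContinuousLinearMap.adjoint L‖ * C) (fun n => ?_) ?_
  · exact (ContinuousLinearMap.le_opNorm _ _).trans (by gcongr; exact hC n)
  · simpa using hw.map (ContinuousLinearMap.adjoint L)

/-- The hypothesis says x = c L* w. It is later a weak eigenvalue equation tested with y, where c =
μ + 1. -/
theorem smul_mulAdjoint {c : ℝ} {w : X} {x : Y} (h : ∀ y, ⟪x, y⟫_ℝ = c * ⟪w, L y⟫_ℝ) :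
    c • mulAdjoint L w = L x := by
  have : x = c • ContinuousLinearMap.adjoint L w := ext_inner_right ℝ fun y => by
    rw [h, real_inner_smul_left, ContinuousLinearMap.adjoint_inner_left]
  rw [this, map_smul, mulAdjoint, ContinuousLinearMap.comp_apply]

theorem exists_of_mulAdjoint {c : ℝ} (hc : c ≠ 0) {w : X} (h : mulAdjoint L w = c⁻¹ • w) :
    ∃ x : Y, L x = w ∧ ∀ y, ⟪x, y⟫_ℝ = c * ⟪w, L y⟫_ℝ := by
  refine ⟨c • ContinuousLinearMap.adjoint L w, ?_, fun y => ?_⟩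
  · rw [map_smul]
    change c • mulAdjoint L w = w
    rw [h, smul_inv_smul₀ hc]
  · rw [real_inner_smul_left, ContinuousLinearMap.adjoint_inner_left]

/-- ‖L* w‖² = ⟪L L* w, w⟫ = 0. -/
theorem inner_eq_zero_of_mulAdjoint {w : X} (h : mulAdjoint L w = 0) (y : Y) :
    ⟪w, L y⟫_ℝ = 0 := by
  have h0 : ContinuousLinearMap.adjoint L w = 0 := by
    rw [← inner_self_eq_zero (𝕜 := ℝ), ← inner_mulAdjoint, h, inner_zero_left]
  rw [← ContinuousLinearMap.adjoint_inner_left, h0, inner_zero_left]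

end Adjoint

/-! ### The resolvent of a quadratic form -/

section Resolvent

variable {X Z : Type*} [NormedAddCommGroup X] [InnerProductSpace ℝ X]
  [NormedAddCommGroup Z] [InnerProductSpace ℝ Z] (V : Submodule ℝ (WithLp 2 (X × Z)))

/-- The first component of an element of a subspace of `X × Z`. -/
def embFst : V →L[ℝ] X := (WithLp.fstL 2 ℝ X Z).comp V.subtypeL

/-- The inner product of V is the form of 1 + A. Hence the adjoint of `embFst V` sends w to the weak
solution of (1 + A) x = w, which is why L L* is the resolvent. -/
theorem inner_subspace {V : Submodule ℝ (WithLp 2 (X × Z))} (x y : V) :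
    ⟪x, y⟫_ℝ = ⟪embFst V x, embFst V y⟫_ℝ +
    ⟪(x : WithLp 2 (X × Z)).snd, (y : WithLp 2 (X × Z)).snd⟫_ℝ :=
  WithLp.prod_inner_apply _ _

variable [CompleteSpace X] [CompleteSpace V]

/-- The inverse of `1 + A`, where `A` is the operator of the form `‖z‖²` for `(x, z)` in `V`. -/
def formResolvent : X →L[ℝ] X := mulAdjoint (embFst V)

variable {V}

theorem isSymmetric_formResolvent : (formResolvent V).IsSymmetric := isSymmetric_mulAdjoint

theorem tendsto_embFst [CompleteSpace Z]
    (hV : ∀ (x : ℕ → WithLp 2 (X × Z)) (C : ℝ), (∀ n, x n ∈ V) → (∀ n, ‖x n‖ ≤ C) →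
      WeakConv x 0 → Tendsto (fun n => (x n).fst) atTop (𝓝 0))
    (x : ℕ → V) (C : ℝ) (hC : ∀ n, ‖x n‖ ≤ C) (hx : WeakConv x 0) :
    Tendsto (fun n => embFst V (x n)) atTop (𝓝 0) :=
  hV (fun n => x n) C (fun n => (x n).2) hC (by simpa using hx.map V.subtypeL)

theorem isCompactOperator_formResolvent [CompleteSpace Z] [SecondCountableTopology X]
    [SecondCountableTopology Z]
    (hV : ∀ (x : ℕ → WithLp 2 (X × Z)) (C : ℝ), (∀ n, x n ∈ V) → (∀ n, ‖x n‖ ≤ C) →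
      WeakConv x 0 → Tendsto (fun n => (x n).fst) atTop (𝓝 0)) :
    IsCompactOperator (formResolvent V) :=
  isCompactOperator_mulAdjoint (tendsto_embFst hV)

theorem tendsto_formResolvent [CompleteSpace Z]
    (hV : ∀ (x : ℕ → WithLp 2 (X × Z)) (C : ℝ), (∀ n, x n ∈ V) → (∀ n, ‖x n‖ ≤ C) →
      WeakConv x 0 → Tendsto (fun n => (x n).fst) atTop (𝓝 0))
    {w : ℕ → X} {C : ℝ} (hC : ∀ n, ‖w n‖ ≤ C) (hw : WeakConv w 0) :
    Tendsto (fun n => formResolvent V (w n)) atTop (𝓝 0) :=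
  tendsto_mulAdjoint (tendsto_embFst hV) hC hw

/-- Adding ⟪x.fst, y.fst⟫ to both sides of the weak equation turns its left side into the inner
product of V. -/
theorem smul_formResolvent_of_weak_eq {μ : ℝ} {x : WithLp 2 (X × Z)} (hx : x ∈ V)
    (h : ∀ y ∈ V, ⟪x.snd, y.snd⟫_ℝ = μ * ⟪x.fst, y.fst⟫_ℝ) :
    (μ + 1) • formResolvent V x.fst = x.fst := by
  refine smul_mulAdjoint (L := embFst V) (x := (⟨x, hx⟩ : V)) fun y => ?_
  rw [inner_subspace]
  change ⟪x.fst, (y : WithLp 2 (X × Z)).fst⟫_ℝ + ⟪x.snd, (y : WithLp 2 (X × Z)).snd⟫_ℝ =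
    (μ + 1) * ⟪x.fst, (y : WithLp 2 (X × Z)).fst⟫_ℝ
  rw [h y y.2]
  ring

theorem weak_eq_of_formResolvent {μ : ℝ} (hμ : μ + 1 ≠ 0) {w : X}
    (h : formResolvent V w = (μ + 1)⁻¹ • w) : ∃ x ∈ V, x.fst = w ∧
      ∀ y ∈ V, ⟪x.snd, y.snd⟫_ℝ = μ * ⟪x.fst, y.fst⟫_ℝ := by
  obtain ⟨x, hxw, hxy⟩ := exists_of_mulAdjoint hμ h
  refine ⟨x, x.2, hxw, fun y hy => ?_⟩
  have h1 := hxy ⟨y, hy⟩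
  rw [inner_subspace, ← hxw] at h1
  change ⟪(x : WithLp 2 (X × Z)).fst, y.fst⟫_ℝ + ⟪(x : WithLp 2 (X × Z)).snd, y.snd⟫_ℝ =
    (μ + 1) * ⟪(x : WithLp 2 (X × Z)).fst, y.fst⟫_ℝ at h1
  linarith

theorem inner_fst_eq_zero_of_formResolvent {w : X} (h : formResolvent V w = 0)
    {y : WithLp 2 (X × Z)} (hy : y ∈ V) : ⟪w, y.fst⟫_ℝ = 0 :=
  inner_eq_zero_of_mulAdjoint h (⟨y, hy⟩ : V)

end Resolvent

/-! ### The Dirichlet eigenspaces -/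

section Dirichlet

variable {d : ℕ} {Ω : Set (E d)}

/-- The inverse of `1 - Δ` on `L²(Ω)`, with zero Dirichlet boundary conditions. -/
def dirichletResolvent (Ω : Set (E d)) : L2 Ω →L[ℝ] L2 Ω :=
  haveI : CompleteSpace (h10 Ω) := (Submodule.isClosed_topologicalClosure _).completeSpace_coe
  formResolvent (h10 Ω)

theorem isSymmetric_dirichletResolvent : (dirichletResolvent Ω).IsSymmetric :=
  isSymmetric_formResolvent

theorem isCompactOperator_dirichletResolvent [IsFiniteMeasure (volume.restrict Ω)]
    (hΩ : MeasurableSet Ω) : IsCompactOperator (dirichletResolvent Ω) :=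
  isCompactOperator_formResolvent (tendsto_fst_of_mem_h10 hΩ)

theorem tendsto_dirichletResolvent [IsFiniteMeasure (volume.restrict Ω)] (hΩ : MeasurableSet Ω)
    {w : ℕ → L2 Ω} {C : ℝ} (hC : ∀ n, ‖w n‖ ≤ C) (hw : WeakConv w 0) :
    Tendsto (fun n => dirichletResolvent Ω (w n)) atTop (𝓝 0) :=
  tendsto_formResolvent (tendsto_fst_of_mem_h10 hΩ) hC hw

/-- The pair `(φ, ∇φ)`. -/
def IsTestFunction.pair {φ : E d → ℝ} (hφ : IsTestFunction Ω φ) : WithLp 2 (L2 Ω × L2Vec Ω) :=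
  WithLp.toLp 2 ((hφ.memLp (volume.restrict Ω)).toLp φ,
    (hφ.memLp_gradient (volume.restrict Ω)).toLp (gradient φ))

theorem IsTestFunction.pair_fst {φ : E d → ℝ} (hφ : IsTestFunction Ω φ) :
    hφ.pair.fst =ᵐ[volume.restrict Ω] φ := (hφ.memLp (volume.restrict Ω)).coeFn_toLp

theorem IsTestFunction.pair_snd {φ : E d → ℝ} (hφ : IsTestFunction Ω φ) :
    hφ.pair.snd =ᵐ[volume.restrict Ω] gradient φ :=
  (hφ.memLp_gradient (volume.restrict Ω)).coeFn_toLp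

theorem IsTestFunction.pair_mem {φ : E d → ℝ} (hφ : IsTestFunction Ω φ) : hφ.pair ∈ h10 Ω :=
  Submodule.le_topologicalClosure _ ⟨φ, hφ, hφ.pair_fst, hφ.pair_snd⟩

theorem inner_of_ae_eq {w v : L2 Ω} {φ : E d → ℝ} (hv : v =ᵐ[volume.restrict Ω] φ) :
    ⟪w, v⟫_ℝ = ∫ x in Ω, w x * φ x := by
  rw [L2.inner_def]
  refine integral_congr_ae ?_
  filter_upwards [hv] with x hx
  rw [hx, Real.inner_apply]

theorem inner_vec_of_ae_eq {g v : L2Vec Ω} {φ : E d → E d} (hv : v =ᵐ[volume.restrict Ω] φ) :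
    ⟪g, v⟫_ℝ = ∫ x in Ω, ⟪g x, φ x⟫_ℝ := by
  rw [L2.inner_def]
  refine integral_congr_ae ?_
  filter_upwards [hv] with x hx
  rw [hx]

/-- Both sides of the weak equation are continuous in the test pair, so it extends from test
functions to their closure, in particular to w itself. -/
theorem IsDirichletEigenfunction.exists_h10 {μ : ℝ} {w : L2 Ω}
    (h : IsDirichletEigenfunction Ω μ w) :
    ∃ x ∈ h10 Ω, x.fst = w ∧ ∀ y ∈ h10 Ω, ⟪x.snd, y.snd⟫_ℝ = μ * ⟪x.fst, y.fst⟫_ℝ := by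
  obtain ⟨g, hg, heq⟩ := h
  refine ⟨WithLp.toLp 2 (w, g), mem_h10_iff.2 hg, rfl, fun y hy => ?_⟩
  have hclosed : IsClosed {y : WithLp 2 (L2 Ω × L2Vec Ω) |
      ⟪g, y.snd⟫_ℝ = μ * ⟪w, y.fst⟫_ℝ} :=
    isClosed_eq (continuous_const.inner (WithLp.sndL 2 ℝ (L2 Ω) (L2Vec Ω)).continuous)
      (continuous_const.mul
        (continuous_const.inner (WithLp.fstL 2 ℝ (L2 Ω) (L2Vec Ω)).continuous))
  refine closure_minimal (s := (testGraph Ω : Set (WithLp 2 (L2 Ω × L2Vec Ω)))) ?_ hclosed hy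
  rintro z ⟨φ, hφ, h1, h2⟩
  rw [mem_ofPred_eq, inner_vec_of_ae_eq h2, heq φ hφ, inner_of_ae_eq h1]

theorem IsDirichletEigenfunction.resolvent_eq {μ : ℝ} {w : L2 Ω}
    (h : IsDirichletEigenfunction Ω μ w) : (μ + 1) • dirichletResolvent Ω w = w := by
  obtain ⟨x, hx, rfl, hxy⟩ := h.exists_h10
  have : CompleteSpace (h10 Ω) := (Submodule.isClosed_topologicalClosure _).completeSpace_coe
  exact smul_formResolvent_of_weak_eq hx hxy

theorem IsDirichletEigenfunction.eq_zero_of_neg {μ : ℝ} (hμ : μ < 0) {w : L2 Ω}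
    (h : IsDirichletEigenfunction Ω μ w) : w = 0 := by
  obtain ⟨x, hx, rfl, hxy⟩ := h.exists_h10
  have h1 := hxy x hx
  rw [real_inner_self_eq_norm_sq, real_inner_self_eq_norm_sq] at h1
  have h3 : ‖x.fst‖ ^ 2 = 0 := by nlinarith [sq_nonneg ‖x.fst‖, sq_nonneg ‖x.snd‖]
  simpa using h3

theorem isDirichletEigenfunction_of_resolvent {μ : ℝ} (hμ : μ + 1 ≠ 0) {w : L2 Ω}
    (h : dirichletResolvent Ω w = (μ + 1)⁻¹ • w) : IsDirichletEigenfunction Ω μ w := by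
  have : CompleteSpace (h10 Ω) := (Submodule.isClosed_topologicalClosure _).completeSpace_coe
  obtain ⟨x, hx, rfl, hxy⟩ := weak_eq_of_formResolvent hμ h
  refine ⟨x.snd, mem_h10_iff.1 hx, fun φ hφ => ?_⟩
  rw [← inner_vec_of_ae_eq hφ.pair_snd, ← inner_of_ae_eq hφ.pair_fst]
  exact hxy _ hφ.pair_mem

/-- The kernel is a closed subspace, so the span and closure in the definition of the eigenspace add
nothing outside it. -/
theorem dirichletEigenspace_le (μ : ℝ) : dirichletEigenspace Ω μ ≤
    ((μ + 1) • dirichletResolvent Ω - ContinuousLinearMap.id ℝ (L2 Ω)).ker := by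
  refine Submodule.topologicalClosure_minimal _ (Submodule.span_le.2 fun w hw => ?_)
    (ContinuousLinearMap.isClosed_ker _)
  have := IsDirichletEigenfunction.resolvent_eq hw
  simp [this]

theorem resolvent_eq_of_mem {μ : ℝ} {w : L2 Ω} (hw : w ∈ dirichletEigenspace Ω μ) :
    (μ + 1) • dirichletResolvent Ω w = w := by
  have := dirichletEigenspace_le μ hw
  simpa [sub_eq_zero] using this

theorem dirichletEigenspace_eq_bot {μ : ℝ} (hμ : μ < 0) : dirichletEigenspace Ω μ = ⊥ := by
  rw [eq_bot_iff]
  refine Submodule.topologicalClosure_minimal _ (Submodule.span_le.2 fun w hw => ?_)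
    isClosed_singleton
  exact IsDirichletEigenfunction.eq_zero_of_neg hμ hw

theorem eigenspace_resolvent_le (ν : ℝ) (hν : ν ≠ 0) :
    Module.End.eigenspace (dirichletResolvent Ω : Module.End ℝ (L2 Ω)) ν ≤
      dirichletEigenspace Ω (ν⁻¹ - 1) := by
  intro w hw
  have hw : dirichletResolvent Ω w = ν • w := Module.End.mem_eigenspace_iff.1 hw
  refine Submodule.le_topologicalClosure _ (Submodule.subset_span ?_)
  refine isDirichletEigenfunction_of_resolvent (by simpa using hν) ?_
  rw [hw, sub_add_cancel, inv_inv]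

/-- Eigenvectors of a symmetric operator. The family is indexed by all reals, including μ = -1, so
the eigenvalue equation is never divided by μ + 1. -/
theorem orthogonalFamily_dirichletEigenspace :
    OrthogonalFamily ℝ (fun μ => dirichletEigenspace Ω μ)
      fun μ => (dirichletEigenspace Ω μ).subtypeₗᵢ := by
  intro μ μ' hne v w
  change ⟪(v : L2 Ω), (w : L2 Ω)⟫_ℝ = 0
  have hv := resolvent_eq_of_mem v.2
  have hw := resolvent_eq_of_mem w.2
  have hs : ⟪dirichletResolvent Ω v, (w : L2 Ω)⟫_ℝ = ⟪(v : L2 Ω), dirichletResolvent Ω w⟫_ℝ :=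
    isSymmetric_dirichletResolvent _ _
  have h1 : (μ + 1) * ⟪dirichletResolvent Ω v, (w : L2 Ω)⟫_ℝ = ⟪(v : L2 Ω), (w : L2 Ω)⟫_ℝ := by
    rw [← real_inner_smul_left, hv]
  have h2 : (μ' + 1) * ⟪dirichletResolvent Ω v, (w : L2 Ω)⟫_ℝ = ⟪(v : L2 Ω), (w : L2 Ω)⟫_ℝ := by
    rw [hs, ← real_inner_smul_right, hw]
  have h3 : (μ - μ') * ⟪dirichletResolvent Ω v, (w : L2 Ω)⟫_ℝ = 0 := by linarith
  rcases mul_eq_zero.1 h3 with h | h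
  · exact absurd (sub_eq_zero.1 h) hne
  · rw [← h1, h, mul_zero]

/-- Such a w is orthogonal to the first components of H¹₀(Ω), hence to all test functions. -/
theorem eq_zero_of_resolvent_eq_zero (hΩ : IsOpen Ω) {w : L2 Ω}
    (h : dirichletResolvent Ω w = 0) : w = 0 := by
  have hloc : LocallyIntegrableOn w Ω volume :=
    locallyIntegrableOn_of_locallyIntegrable_restrict
      ((Lp.memLp w).locallyIntegrable (by norm_num))
  have hae := hΩ.ae_eq_zero_of_integral_contDiff_smul_eq_zero hloc fun φ h1 h2 h3 => by
    have hφ : IsTestFunction Ω φ := ⟨h1, h2, h3⟩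
    have : CompleteSpace (h10 Ω) := (Submodule.isClosed_topologicalClosure _).completeSpace_coe
    have e1 := inner_fst_eq_zero_of_formResolvent h hφ.pair_mem
    rw [inner_of_ae_eq hφ.pair_fst] at e1
    rw [← setIntegral_eq_integral_of_forall_compl_eq_zero (s := Ω), ← e1]
    · exact integral_congr_ae (Eventually.of_forall fun x => by simp [mul_comm])
    · intro x hx
      rw [hφ.eq_zero hx, zero_smul]
  rw [Lp.eq_zero_iff_ae_eq_zero]
  exact (ae_restrict_iff' hΩ.measurableSet).2 hae

/-- Spectral theorem for the compact symmetric resolvent: its eigenspace for ν ≠ 0 lies in the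
Dirichlet eigenspace for ν⁻¹ - 1, and its kernel is trivial. -/
theorem isHilbertSum_dirichletEigenspace [IsFiniteMeasure (volume.restrict Ω)] (hΩ : IsOpen Ω) :
    IsHilbertSum ℝ (fun μ => dirichletEigenspace Ω μ)
      fun μ => (dirichletEigenspace Ω μ).subtypeₗᵢ := by
  refine IsHilbertSum.mkInternal (F := fun μ => dirichletEigenspace Ω μ)
    orthogonalFamily_dirichletEigenspace ?_
  rw [top_le_iff, Submodule.topologicalClosure_eq_top_iff, eq_bot_iff,
    ← ContinuousLinearMap.orthogonalComplement_iSup_eigenspaces_eq_bot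
      (isCompactOperator_dirichletResolvent hΩ.measurableSet) isSymmetric_dirichletResolvent]
  refine Submodule.orthogonal_le (iSup_le fun ν => ?_)
  rcases eq_or_ne ν 0 with rfl | hν
  · intro w hw
    have : dirichletResolvent Ω w = (0 : ℝ) • w := Module.End.mem_eigenspace_iff.1 hw
    rw [zero_smul] at this
    rw [eq_zero_of_resolvent_eq_zero hΩ this]
    exact zero_mem _
  · exact (eigenspace_resolvent_le ν hν).trans
      (le_iSup (fun μ => dirichletEigenspace Ω μ) (ν⁻¹ - 1))

end Dirichlet

/-! ### The model of the spectral space -/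

section Spectral

variable {d : ℕ} {s : ℝ} {Ω : Set (E d)}

theorem rpow_half_sq {μ : ℝ} (hμ : 0 ≤ μ) : (μ ^ (s / 2)) ^ 2 = μ ^ s := by
  rw [← Real.rpow_natCast, ← Real.rpow_mul hμ]
  congr 1
  push_cast
  ring

/-- With M = δ^{-1/s}, the first term is at least 1 for μ ≥ M, and the second, with C = (M + 1)²,
for μ ≤ M. -/
theorem exists_one_le_rpow_add (hs : 0 < s) {δ : ℝ} (hδ : 0 < δ) :
    ∃ C : ℝ, 0 ≤ C ∧ ∀ μ : ℝ, 0 ≤ μ → 1 ≤ δ * μ ^ s + C * ((μ + 1)⁻¹) ^ 2 := by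
  set M := (δ⁻¹) ^ s⁻¹ with hM
  have hM0 : 0 ≤ M := Real.rpow_nonneg (inv_nonneg.2 hδ.le) _
  refine ⟨(M + 1) ^ 2, sq_nonneg _, fun μ hμ => ?_⟩
  have h1 : 0 ≤ δ * μ ^ s := mul_nonneg hδ.le (Real.rpow_nonneg hμ _)
  have h2 : 0 ≤ (M + 1) ^ 2 * ((μ + 1)⁻¹) ^ 2 := by positivity
  rcases le_total M μ with h | h
  · have h3 : δ⁻¹ ≤ μ ^ s := by
      have := Real.rpow_le_rpow hM0 h hs.le
      rwa [hM, Real.rpow_inv_rpow (inv_nonneg.2 hδ.le) hs.ne'] at this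
    have h4 := mul_le_mul_of_nonneg_left h3 hδ.le
    rw [mul_inv_cancel₀ hδ.ne'] at h4
    linarith
  · have h3 : 1 ≤ (M + 1) * (μ + 1)⁻¹ := by
      rw [← div_eq_mul_inv, one_le_div (by linarith)]
      linarith
    have h4 : 1 ≤ ((M + 1) * (μ + 1)⁻¹) ^ 2 := one_le_pow₀ h3
    rw [mul_pow] at h4
    linarith

theorem projection_eq_zero_of_neg {μ : ℝ} (hμ : μ < 0) (w : L2 Ω) :
    (dirichletEigenspace Ω μ).orthogonalProjectionOnto w = 0 := by
  have h := ((dirichletEigenspace Ω μ).orthogonalProjectionOnto w).2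
  rw [← Submodule.coe_eq_zero]
  exact (Submodule.eq_bot_iff _).1 (dirichletEigenspace_eq_bot hμ) _ h

theorem projection_resolvent {μ : ℝ} (hμ : 0 ≤ μ) (w : L2 Ω) :
    (dirichletEigenspace Ω μ).orthogonalProjectionOnto (dirichletResolvent Ω w) =
      (μ + 1)⁻¹ • (dirichletEigenspace Ω μ).orthogonalProjectionOnto w := by
  refine ext_inner_right ℝ fun e => ?_
  have he := resolvent_eq_of_mem e.2
  have hμ1 : μ + 1 ≠ 0 := by positivity
  have he' : dirichletResolvent Ω e = (μ + 1)⁻¹ • (e : L2 Ω) := by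
    rw [eq_inv_smul_iff₀ hμ1, he]
  have hsymm : ⟪dirichletResolvent Ω w, (e : L2 Ω)⟫_ℝ = ⟪w, dirichletResolvent Ω e⟫_ℝ :=
    isSymmetric_dirichletResolvent _ _
  rw [← map_smul, Submodule.inner_orthogonalProjectionOnto_eq_of_mem_right,
    Submodule.inner_orthogonalProjectionOnto_eq_of_mem_right, hsymm, he', real_inner_smul_right,
    real_inner_smul_left]

/-- The pairs `(w, h)` such that the coefficients of `h` are those of `w` times `μ^{s/2}`. -/
def spectralGraph (s : ℝ) (Ω : Set (E d)) : Submodule ℝ (WithLp 2 (L2 Ω × L2 Ω)) where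
  carrier := {x | ∀ μ : ℝ, (dirichletEigenspace Ω μ).orthogonalProjectionOnto x.snd =
    μ ^ (s / 2) • (dirichletEigenspace Ω μ).orthogonalProjectionOnto x.fst}
  zero_mem' := fun μ => by simp
  add_mem' := fun {a b} ha hb μ => by
    rw [WithLp.add_snd, WithLp.add_fst, map_add, map_add, ha μ, hb μ, smul_add]
  smul_mem' := fun c a ha μ => by
    rw [WithLp.smul_snd, WithLp.smul_fst, map_smul, map_smul, ha μ, smul_comm]

theorem isClosed_spectralGraph :
    IsClosed (spectralGraph s Ω : Set (WithLp 2 (L2 Ω × L2 Ω))) := by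
  have : (spectralGraph s Ω : Set (WithLp 2 (L2 Ω × L2 Ω))) = ⋂ μ : ℝ,
      {x | (dirichletEigenspace Ω μ).orthogonalProjectionOnto x.snd =
        μ ^ (s / 2) • (dirichletEigenspace Ω μ).orthogonalProjectionOnto x.fst} := by
    ext x
    simp only [mem_iInter]
    rfl
  rw [this]
  refine isClosed_iInter fun μ => isClosed_eq ?_ ?_
  · exact ((dirichletEigenspace Ω μ).orthogonalProjectionOnto).continuous.comp
      (WithLp.sndL 2 ℝ (L2 Ω) (L2 Ω)).continuous
  · exact (μ ^ (s / 2) • (dirichletEigenspace Ω μ).orthogonalProjectionOnto).continuous.comp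
      (WithLp.fstL 2 ℝ (L2 Ω) (L2 Ω)).continuous

/-- For μ < 0 the projection vanishes, so the conventional values of real powers of negative numbers
do not matter. -/
theorem norm_sq_projection_smul {μ : ℝ} (w : L2 Ω) :
    ‖μ ^ (s / 2) • (dirichletEigenspace Ω μ).orthogonalProjectionOnto w‖ ^ 2 =
      μ ^ s * ‖(dirichletEigenspace Ω μ).orthogonalProjectionOnto w‖ ^ 2 := by
  rcases lt_or_ge μ 0 with hμ | hμ
  · rw [projection_eq_zero_of_neg hμ]
    simp
  · rw [norm_smul, mul_pow, Real.norm_eq_abs, sq_abs, rpow_half_sq hμ]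

theorem spectral_term {μ : ℝ} (w : L2 Ω) : ENNReal.ofReal (μ ^ s) *
      ENNReal.ofReal (‖(dirichletEigenspace Ω μ).orthogonalProjectionOnto w‖ ^ 2) =
    ENNReal.ofReal
      (‖μ ^ (s / 2) • (dirichletEigenspace Ω μ).orthogonalProjectionOnto w‖ ^ 2) := by
  rw [norm_sq_projection_smul]
  rcases lt_or_ge μ 0 with hμ | hμ
  · rw [projection_eq_zero_of_neg hμ]
    simp
  · rw [ENNReal.ofReal_mul (Real.rpow_nonneg hμ _)]

variable [IsFiniteMeasure (volume.restrict Ω)]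

theorem spectralGraph_normSq (hΩ : IsOpen Ω) {x : WithLp 2 (L2 Ω × L2 Ω)}
    (hx : x ∈ spectralGraph s Ω) : spectralNormSq s Ω x.fst = ENNReal.ofReal (‖x.snd‖ ^ 2) := by
  have h := IsHilbertSum.hasSum_norm_sq (F := fun μ => dirichletEigenspace Ω μ)
    (isHilbertSum_dirichletEigenspace hΩ) x.snd
  rw [spectralNormSq, ← h.tsum_eq, ENNReal.ofReal_tsum_of_nonneg (fun μ => sq_nonneg _) h.summable]
  refine tsum_congr fun μ => ?_
  rw [spectral_term, hx μ]

theorem exists_mem_spectralGraph (hΩ : IsOpen Ω) {w : L2 Ω} (hw : spectralNormSq s Ω w < ⊤) :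
    ∃ x ∈ spectralGraph s Ω, x.fst = w := by
  have hsum : Summable fun μ : ℝ =>
      ‖μ ^ (s / 2) • (dirichletEigenspace Ω μ).orthogonalProjectionOnto w‖ ^ 2 := by
    rw [spectralNormSq] at hw
    simp only [spectral_term] at hw
    refine (ENNReal.summable_toReal hw.ne).congr fun μ => ?_
    rw [ENNReal.toReal_ofReal (sq_nonneg _)]
  obtain ⟨h, hh⟩ := IsHilbertSum.exists_orthogonalProjectionOnto_eq
    (F := fun μ => dirichletEigenspace Ω μ) (isHilbertSum_dirichletEigenspace hΩ) hsum
  exact ⟨WithLp.toLp 2 (w, h), hh, rfl⟩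

/-- An Ehrling-type inequality: the scalar bound is multiplied by ‖P_μ w‖² and summed over μ by
Parseval. -/
theorem norm_sq_le_of_mem_spectralGraph (hΩ : IsOpen Ω) {δ C : ℝ}
    (hC : ∀ μ : ℝ, 0 ≤ μ → 1 ≤ δ * μ ^ s + C * ((μ + 1)⁻¹) ^ 2)
    {x : WithLp 2 (L2 Ω × L2 Ω)} (hx : x ∈ spectralGraph s Ω) :
    ‖x.fst‖ ^ 2 ≤ δ * ‖x.snd‖ ^ 2 + C * ‖dirichletResolvent Ω x.fst‖ ^ 2 := by
  have hH := fun w : L2 Ω => IsHilbertSum.hasSum_norm_sq (F := fun μ => dirichletEigenspace Ω μ)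
    (isHilbertSum_dirichletEigenspace hΩ) w
  refine hasSum_le (fun μ => ?_) (hH x.fst)
    (((hH x.snd).mul_left δ).add ((hH (dirichletResolvent Ω x.fst)).mul_left C))
  rcases lt_or_ge μ 0 with hμ | hμ
  · simp only [projection_eq_zero_of_neg hμ]
    simp
  · have h1 := mul_le_mul_of_nonneg_right (hC μ hμ)
      (sq_nonneg ‖(dirichletEigenspace Ω μ).orthogonalProjectionOnto x.fst‖)
    simp only [hx μ, norm_sq_projection_smul, projection_resolvent hμ]
    rw [norm_smul, mul_pow, Real.norm_eq_abs, sq_abs]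
    linarith

/-- The compact resolvent maps the weakly null first components to a strongly null sequence. The
remaining term of the Ehrling-type inequality is small by the choice of δ. -/
theorem spectralGraph_compact (hΩ : IsOpen Ω) (hs : 0 < s)
    {x : ℕ → WithLp 2 (L2 Ω × L2 Ω)} {B : ℝ} (hx : ∀ n, x n ∈ spectralGraph s Ω)
    (hB : ∀ n, ‖x n‖ ≤ B) (hx0 : WeakConv x 0) :
    Tendsto (fun n => ‖(x n).fst‖ ^ 2) atTop (𝓝 0) := by
  have hB0 : 0 ≤ B := (norm_nonneg _).trans (hB 0)
  have hn : ∀ n, ‖(x n).fst‖ ^ 2 ≤ B ^ 2 ∧ ‖(x n).snd‖ ^ 2 ≤ B ^ 2 := fun n => by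
    have h1 := WithLp.prod_norm_sq_eq_of_L2 (x n)
    have h2 := pow_le_pow_left₀ (norm_nonneg _) (hB n) 2
    constructor <;> nlinarith [sq_nonneg ‖(x n).fst‖, sq_nonneg ‖(x n).snd‖]
  have hR : Tendsto (fun n => ‖dirichletResolvent Ω (x n).fst‖ ^ 2) atTop (𝓝 0) := by
    have := (tendsto_dirichletResolvent hΩ.measurableSet (w := fun n => (x n).fst)
      (fun n => le_of_sq_le_sq (hn n).1 hB0)
      (by simpa using hx0.map (WithLp.fstL 2 ℝ (L2 Ω) (L2 Ω)))).norm.pow 2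
    simpa using this
  refine tendsto_order.2 ⟨fun a ha => Eventually.of_forall fun n => ha.trans_le (sq_nonneg _),
    fun a ha => ?_⟩
  -- With this δ the term δ‖h‖² is at most a/2; the summand 1 covers B = 0.
  have hδ : 0 < a / 2 / (B ^ 2 + 1) := by positivity
  obtain ⟨C, hC0, hC⟩ := exists_one_le_rpow_add hs hδ
  have hCR := hR.const_mul C
  rw [mul_zero] at hCR
  filter_upwards [hCR.eventually (gt_mem_nhds (half_pos ha))] with n hn'
  have h1 := norm_sq_le_of_mem_spectralGraph hΩ hC (hx n)
  have h2 : a / 2 / (B ^ 2 + 1) * ‖(x n).snd‖ ^ 2 ≤ a / 2 := by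
    rw [div_mul_eq_mul_div, div_le_iff₀ (by positivity)]
    exact mul_le_mul_of_nonneg_left ((hn n).2.trans (by linarith)) (half_pos ha).le
  linarith

/-- The model of `ℍ^s(Ω)`. -/
def spectralModel (hΩ : IsOpen Ω) (hs : 0 < s) : SobolevModel .spectral s Ω (L2 Ω) where
  θ := 0
  θ_nonneg := le_rfl
  graph := spectralGraph s Ω
  isClosed := isClosed_spectralGraph
  mem_W w := by
    refine ⟨exists_mem_spectralGraph hΩ, ?_⟩
    rintro ⟨x, hx, rfl⟩
    change spectralNormSq s Ω x.fst < ⊤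
    rw [spectralGraph_normSq hΩ hx]
    exact ENNReal.ofReal_lt_top
  normSq x hx := by
    rw [zero_mul, zero_add]
    exact spectralGraph_normSq hΩ hx
  compact x B hx hB hx0 r _ := by
    refine squeeze_zero (fun n => integral_nonneg fun z => sq_nonneg _) (fun n => ?_)
      (spectralGraph_compact hΩ hs hx hB hx0)
    rw [Lp_norm_sq]
    exact setIntegral_le_integral (integrable_sq _) (Eventually.of_forall fun z => sq_nonneg _)

end Spectral

end SparseFrac

end

/-! ### The theorem for the four spaces -/

open SparseFrac in
theorem mainTheorem3 {d : ℕ} (hd : 1 ≤ d) (Ω : Set (E d)) (hΩ : IsBoundedLipschitzDomain Ω)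
    (T : ℝ) (hT : 0 < T)
    (κ : SpaceKind) (s : ℝ) (hs : s ∈ Ioo (0 : ℝ) 1)
    (f : U T Ω → ℝ) (hf_lsc : WeaklyLSC f)
    (hf_bdd : ∃ (g : U T Ω →L[ℝ] ℝ) (c : ℝ), ∀ u : U T Ω, g u + c ≤ f u)
    (hf_C1 : ContDiff ℝ 1 f)
    (α β γ p : ℝ) (hα : 0 < α) (hβ : 0 < β) (hγ : 0 < γ) (hp : p ∈ Ioo (0 : ℝ) 1)
    (ρ : ℝ) (hρ : 0 < ρ) (ubar : U T Ω) (wbar : L2 Ω)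
    (hloc : IsLocalSolution κ s T Ω f α β γ p ρ ubar wbar)
    (ε : ℕ → ℝ) (hε_pos : ∀ k, 0 < ε k) (hε : Tendsto ε atTop (𝓝 0))
    (u : ℕ → U T Ω) (w : ℕ → L2 Ω)
    (hsol : ∀ k, IsAuxSolution κ s T Ω f α β γ p ρ ubar wbar (ε k) (u k) (w k)) :
    Tendsto u atTop (𝓝 ubar) ∧
      Tendsto (fun k => wNorm κ s Ω (w k - wbar)) atTop (𝓝 0) := by
  have : IsFiniteMeasure (volume.restrict Ω) :=
    ⟨by simpa using hΩ.isBounded.measure_lt_top⟩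
  cases κ with
  | full =>
    -- With D = Ω the extension by zero is harmless, as only values in Ω enter the norm; with D =
    -- ℝ^d the same model gives the tilde space.
    exact (gagliardoModel hs hΩ.isOpen.measurableSet Subset.rfl .full
      (fun w => hsNormSq_indicator hΩ.isOpen.measurableSet _) (fun w => Iff.rfl)).tendsto_solutions
      hΩ.isOpen hα hβ hγ hp hρ hf_lsc hf_bdd hloc hε_pos hε hsol
  | zero =>
    exact (zeroModel hs hΩ.isOpen.measurableSet).tendsto_solutions hΩ.isOpen hα hβ hγ
      hp hρ hf_lsc hf_bdd hloc hε_pos hε hsol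
  | tilde =>
    exact (gagliardoModel hs hΩ.isOpen.measurableSet (subset_univ _) .tilde
      (fun w => rfl) (fun w => Iff.rfl)).tendsto_solutions hΩ.isOpen hα hβ hγ
      hp hρ hf_lsc hf_bdd hloc hε_pos hε hsol
  | spectral =>
    exact (spectralModel hΩ.isOpen hs.1).tendsto_solutions hΩ.isOpen hα hβ hγ
      hp hρ hf_lsc hf_bdd hloc hε_pos hε hsol
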